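/- Model. Wi-Fi access points (APs) $\Phi_W=\{x_i\}$ and LTE eNBs $\Phi_L=\{y_k\}$ form two independent homogeneous Poisson point processes in $\mathbb R^2$ with intensities $\lambda_W,\lambda_L>0$ and transmit powers $P_W,P_L>0$. The path loss is $l(d)=(4\pi/\lambda_c)^2d^{\alpha}$ with wavelength $\lambda_c>0$ and exponent $\alpha>0$. AP timers $t^W_i$ are uniform on $[0,1]$, eNB timers $t^L_k$ are uniform on $[a,b]$, and the fadings $G^W_{ji}$ (AP $x_j$ to AP $x_i$), $G^{LW}_{mi}$ (eNB $y_m$ to AP $x_i$), $G^{WL}_{jk}$ (AP $x_j$ to eNB $y_k$), $G^{L}_{mk}$ (eNB $y_m$ to eNB $y_k$) are exponential with parameter $\mu>0$; all timers and fadings are mutually independent and independent of $(\Phi_W,\Phi_L)$. Given sensing thresholds $\Gamma_{cs},\Gamma_{ed},\Gamma^L>0$, the medium access indicators under listen-before-talk with random back-off are $$e^W_i=\prod_{x_j\in\Phi_W\setminus\{x_i\}}\Bigl(\mathbf 1_{t^W_j\ge t^W_i}+\mathbf 1_{t^W_j<t^W_i}\mathbf 1_{G^W_{ji}/l(\|x_j-x_i\|)\le\Gamma_{cs}/P_W}\Bigr)\prod_{y_m\in\Phi_L}\Bigl(\mathbf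 1_{t^L_m\ge t^W_i}+\mathbf 1_{t^L_m<t^W_i}\mathbf 1_{G^{LW}_{mi}/l(\|y_m-x_i\|)\le\Gamma_{ed}/P_L}\Bigr),$$ $$e^L_k=\prod_{x_j\in\Phi_W}\Bigl(\mathbf 1_{t^W_j\ge t^L_k}+\mathbf 1_{t^W_j<t^L_k}\mathbf 1_{G^{WL}_{jk}/l(\|y_k-x_j\|)\le\Gamma^L/P_W}\Bigr)\prod_{y_m\in\Phi_L\setminus\{y_k\}}\Bigl(\mathbf 1_{t^L_m\ge t^L_k}+\mathbf 1_{t^L_m<t^L_k}\mathbf 1_{G^{L}_{mk}/l(\|y_m-y_k\|)\le\Gamma^L/P_L}\Bigr).$$ The tagged AP $x_0$ (tagged eNB $y_0$) is the AP (eNB) closest to the origin, and its medium access probability (MAP) is $\mathbb P(e^W_0=1)$ (resp. $\mathbb P(e^L_0=1)$). Notation. For $y\in\mathbb R^2$, $r\ge 0$, $\Gamma>0$ and $Q\in\{W,L\}$ let $$N^Q_0(y,r,\Gamma)=\lambda_Q\int_{\mathbb R^2\setminus B(0,r)}\exp\Bigl(-\mu\frac{\Gamma}{P_Q}\,l(\|x-y\|)\Bigr)\,dx,$$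 where $B(0,r)$ is the closed ball, and put $N^W_2(r)=N^W_0((r,0),r,\Gamma_{cs})$, $N^L_1(r,\Gamma)=N^L_0((r,0),r,\Gamma)$, $N^W_3(\Gamma)=N^W_0(0,0,\Gamma)$ and $f_Q(r)=2\pi\lambda_Q r\,e^{-\lambda_Q\pi r^2}$. Claim. If the back-off window of LTE is $(a,b)=(1,2)$, then the MAPs of the tagged AP and of the tagged eNB are $$\hat p^W_{4}=\int_0^\infty\frac{1-e^{-N^W_2(r_0)}}{N^W_2(r_0)}\,f_W(r_0)\,dr_0,\qquad \hat p^L_{4}=\int_0^\infty e^{-N^W_3(\Gamma^L)}\,\frac{1-e^{-N^L_1(r_0,\Gamma^L)}}{N^L_1(r_0,\Gamma^L)}\,f_L(r_0)\,dr_0,$$ where $N^W_2(r_0)$, $N^L_1(r_0,\Gamma^L)$ (for $r_0>0$) and $N^W_3(\Gamma^L)$ are finite and strictly positive and both integrals converge. -/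

import Mathlib

open MeasureTheory ProbabilityTheory

noncomputable section

namespace Coexistence

/-- The plane, with the Euclidean norm. -/
abbrev Plane : Type := EuclideanSpace ℝ (Fin 2)

/-- System parameters, in linear scale: AP and eNB intensities, transmit powers, the carrier sense
and energy detection thresholds of the APs, the common sensing threshold of the eNBs, the Rayleigh
fading parameter, the path loss exponent and the wavelength. -/
structure Params where
  lamW : ℝ
  lamL : ℝ
  PW : ℝ
  PL : ℝ
  Γcs : ℝ
  Γed : ℝ
  ΓL : ℝ
  μ : ℝ
  α : ℝ
  lamc : ℝ
  lamW_pos : 0 < lamW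
  lamL_pos : 0 < lamL
  PW_pos : 0 < PW
  PL_pos : 0 < PL
  Γcs_pos : 0 < Γcs
  Γed_pos : 0 < Γed
  ΓL_pos : 0 < ΓL
  μ_pos : 0 < μ
  α_pos : 0 < α
  lamc_pos : 0 < lamc

/-- Path loss at distance `d`: the linear form `10 ^ (L / 10)` of
`L = 20 log₁₀ (4π / lamc) + 10 α log₁₀ d` decibel. -/
def Params.pathLoss (p : Params) (d : ℝ) : ℝ :=
  (4 * Real.pi / p.lamc) ^ 2 * d ^ p.α

/-- Number of points of the sequence `x` in `A` (used where this number is finite). -/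
def count {E : Type*} (x : ℕ → E) (A : Set E) : ℕ := Set.ncard {i | x i ∈ A}

/-- The random points `X 0, X 1, …` enumerate a homogeneous Poisson point process of intensity
`lam` in the plane: sets of finite area hold almost surely finitely many points, the number of
points in such a set is Poisson with mean `lam` times the area, and the numbers of points in
disjoint sets are independent. -/
structure IsHomogeneousPPP {Ω : Type*} [MeasurableSpace Ω] (P : Measure Ω) (lam : ℝ)
    (X : ℕ → Ω → Plane) : Prop where
  measurable : ∀ i, Measurable (X i)
  finite : ∀ A : Set Plane, MeasurableSet A → volume A ≠ ⊤ →
    ∀ᵐ ω ∂P, {i | X i ω ∈ A}.Finite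
  poisson : ∀ A : Set Plane, MeasurableSet A → volume A ≠ ⊤ →
    HasLaw (fun ω => count (fun i => X i ω) A)
      (poissonMeasure (lam * volume.real A).toNNReal) P
  indep : ∀ (n : ℕ) (A : Fin n → Set Plane), (∀ s, MeasurableSet (A s)) →
    (∀ s, volume (A s) ≠ ⊤) → (∀ s t, s ≠ t → Disjoint (A s) (A t)) →
    iIndepFun (fun s ω => count (fun i => X i ω) (A s)) P

/-- Labels of the random marks: back-off timers of AP `i` and eNB `k`, and the fadings
AP `j` → AP `i`, eNB `m` → AP `i`, AP `j` → eNB `k`, eNB `m` → eNB `k`. -/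
inductive Mark : Type
  | timerW (i : ℕ)
  | timerL (k : ℕ)
  | fadeW (j i : ℕ)
  | fadeLW (m i : ℕ)
  | fadeWL (j k : ℕ)
  | fadeL (m k : ℕ)

/-- AP timers are uniform on `[0,1]`, eNB timers uniform on `[a,b]`, and the fadings are
exponential with parameter `μ` (mean `1 / μ`). -/
def markLaw (p : Params) (a b : ℝ) : Mark → Measure ℝ
  | .timerW _ => cond volume (Set.Icc 0 1)
  | .timerL _ => cond volume (Set.Icc a b)
  | .fadeW _ _ => expMeasure p.μ
  | .fadeLW _ _ => expMeasure p.μ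
  | .fadeWL _ _ => expMeasure p.μ
  | .fadeL _ _ => expMeasure p.μ

/-- The network in which LTE uses the back-off window `(a,b)`: the APs `X` and the eNBs `Y` are
independent homogeneous Poisson point processes; the timers and fadings are mutually
independent, with the above laws, and independent of the locations. -/
structure IsNetwork {Ω : Type*} [MeasurableSpace Ω] (P : Measure Ω) (p : Params) (a b : ℝ)
    (X Y : ℕ → Ω → Plane) (Z : Mark → Ω → ℝ) : Prop where
  pppW : IsHomogeneousPPP P p.lamW X
  pppL : IsHomogeneousPPP P p.lamL Y
  indepWL : IndepFun (fun ω i => X i ω) (fun ω k => Y k ω) P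
  measurable_mark : ∀ m, Measurable (Z m)
  law_mark : ∀ m, HasLaw (Z m) (markLaw p a b m) P
  indep_mark : iIndepFun Z P
  indep_loc_mark :
    IndepFun (fun ω => ((fun i => X i ω), (fun k => Y k ω))) (fun ω m => Z m ω) P

open Classical in
/-- The factor `1_{t' ≥ t} + 1_{t' < t} 1_{G / l(d) ≤ Γ / Q}` which a transmitter with timer `t'`,
transmit power `Q`, at distance `d` and with fading `G` contributes to the medium access indicator
of a node with timer `t` and sensing threshold `Γ`. -/
def accessFactor (p : Params) (t' t G d Γ Q : ℝ) : ℝ :=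
  (if t' ≥ t then 1 else 0) +
    (if t' < t then 1 else 0) * (if G / p.pathLoss d ≤ Γ / Q then 1 else 0)

section Indicators

variable {Ω : Type*} (p : Params) (X Y : ℕ → Ω → Plane) (Z : Mark → Ω → ℝ)

/-- Medium access indicator of AP `i`. (A product of factors in `{0,1}` always converges, to the
indicator that all the factors are `1`.) -/
def accessW (i : ℕ) (ω : Ω) : ℝ :=
  (∏' j : {j : ℕ // j ≠ i}, accessFactor p (Z (.timerW j) ω) (Z (.timerW i) ω)
      (Z (.fadeW j i) ω) ‖X j ω - X i ω‖ p.Γcs p.PW) *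
    ∏' m : ℕ, accessFactor p (Z (.timerL m) ω) (Z (.timerW i) ω)
      (Z (.fadeLW m i) ω) ‖Y m ω - X i ω‖ p.Γed p.PL

/-- Medium access indicator of eNB `k`. -/
def accessL (k : ℕ) (ω : Ω) : ℝ :=
  (∏' j : ℕ, accessFactor p (Z (.timerW j) ω) (Z (.timerL k) ω)
      (Z (.fadeWL j k) ω) ‖Y k ω - X j ω‖ p.ΓL p.PW) *
    ∏' m : {m : ℕ // m ≠ k}, accessFactor p (Z (.timerL m) ω) (Z (.timerL k) ω)
      (Z (.fadeL m k) ω) ‖Y m ω - Y k ω‖ p.ΓL p.PL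

end Indicators

/-- Index of the tagged node: the one closest to the origin, where the typical user is. -/
def tagged {Ω : Type*} (X : ℕ → Ω → Plane) (ω : Ω) : ℕ :=
  sInf {i | ∀ j, ‖X i ω‖ ≤ ‖X j ω‖}

/-- Medium access probability of the tagged AP. -/
def taggedMAPW {Ω : Type*} [MeasurableSpace Ω] (P : Measure Ω) (p : Params)
    (X Y : ℕ → Ω → Plane) (Z : Mark → Ω → ℝ) : ℝ :=
  P.real {ω | accessW p X Y Z (tagged X ω) ω = 1}

/-- Medium access probability of the tagged eNB. -/
def taggedMAPL {Ω : Type*} [MeasurableSpace Ω] (P : Measure Ω) (p : Params)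
    (X Y : ℕ → Ω → Plane) (Z : Mark → Ω → ℝ) : ℝ :=
  P.real {ω | accessL p X Y Z (tagged Y ω) ω = 1}

namespace Params

variable (p : Params)

/-- Mean number of eNBs outside `B(0,r)` whose power received at `y` exceeds `Γ`. -/
def N0L (y : Plane) (r Γ : ℝ) : ℝ :=
  p.lamL * ∫ x in (Metric.closedBall (0 : Plane) r)ᶜ,
    Real.exp (-p.μ * (Γ / p.PL) * p.pathLoss ‖x - y‖)

/-- Mean number of APs outside `B(0,r)` whose power received at `y` exceeds `Γ`. -/
def N0W (y : Plane) (r Γ : ℝ) : ℝ :=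
  p.lamW * ∫ x in (Metric.closedBall (0 : Plane) r)ᶜ,
    Real.exp (-p.μ * (Γ / p.PW) * p.pathLoss ‖x - y‖)

def N1L (r Γ : ℝ) : ℝ := p.N0L !₂[r, 0] r Γ

def N2W (r : ℝ) : ℝ := p.N0W !₂[r, 0] r p.Γcs

def N3W (Γ : ℝ) : ℝ := p.N0W 0 0 Γ

/-- Density of the distance from the origin to the closest AP. -/
def fW (r : ℝ) : ℝ :=
  p.lamW * 2 * Real.pi * r * Real.exp (-p.lamW * Real.pi * r ^ 2)

/-- Density of the distance from the origin to the closest eNB. -/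
def fL (r : ℝ) : ℝ :=
  p.lamL * 2 * Real.pi * r * Real.exp (-p.lamL * Real.pi * r ^ 2)

end Params

end Coexistence

end

/-! With AP timers in [0,1] and eNB timers in [1,2], almost surely every AP timer precedes every eNB
timer. So no eNB ever silences an AP, while an eNB is silenced by every AP it detects, whatever the
timers. Within its own system, a tagged node with timer `t` in a window [a, a+1] is silenced by
another node with probability s·exp(-μθ l(d)), where s = t - a is the probability that the other
timer is smaller and θ is the ratio of threshold to power. Given the locations and `t`, independence
of the marks turns the access probability into an infinite product over the other nodes
(`measure_forall_access`).

Two Poisson formulas average this product over the locations. The probability generating functional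
(`IsHomogeneousPPP.lintegral_seqProd`) handles the APs seen by the tagged eNB: by translation
invariance its value exp(-N₃) does not depend on where the eNB is, so it factors out. The second
formula (`IsHomogeneousPPP.lintegral_palmProd`) concerns a process seen from its own closest point:
that point has density λ·exp(-λπ|x|²), and given it the others behave as a Poisson process outside
B(0,|x|). It yields exp(-sN(|x|)). Integrating over s in [0,1] gives (1 - exp(-N))/N, rotation
invariance brings x to (|x|, 0), and polar coordinates turn the density into f.

The second formula is derived from counts alone. Let w vanish at every point at most as far out as
some point of A. Then "the closest point lies in A", weighted by the product of w over the other
points, equals "A holds exactly one point", weighted by the product of w over the points outside A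
(`indicator_palmProd_eq`). Counts in disjoint sets are independent, so the expectation is explicit.
Kernels depending on the closest point through a countable label follow by summing over cells, and
continuous kernels by approximation. -/

noncomputable section

namespace Coexistence

open Filter Topology
open scoped ENNReal

/-! ### Infinite products of factors in [0,1]. -/

/-- The infinite product of a sequence of factors in `[0,1]`, as the infimum of its partial
products. -/
def seqProd (w : ℕ → ℝ≥0∞) : ℝ≥0∞ := ⨅ n, ∏ j ∈ Finset.range n, w j

lemma seqProd_le_one (w : ℕ → ℝ≥0∞) : seqProd w ≤ 1 := (iInf_le _ 0).trans (by simp)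

lemma antitone_prod_range {w : ℕ → ℝ≥0∞} (h : ∀ j, w j ≤ 1) :
    Antitone fun n => ∏ j ∈ Finset.range n, w j :=
  antitone_nat_of_succ_le fun n => by
    rw [Finset.prod_range_succ]
    exact mul_le_of_le_one_right' (h n)

lemma tendsto_seqProd {w : ℕ → ℝ≥0∞} (h : ∀ j, w j ≤ 1) :
    Tendsto (fun n => ∏ j ∈ Finset.range n, w j) atTop (𝓝 (seqProd w)) :=
  tendsto_atTop_iInf (antitone_prod_range h)

lemma seqProd_eq_prod {w : ℕ → ℝ≥0∞} (h : ∀ j, w j ≤ 1) (s : Finset ℕ)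
    (hs : ∀ j ∉ s, w j = 1) : seqProd w = ∏ j ∈ s, w j := by
  refine tendsto_nhds_unique (tendsto_seqProd h) ?_
  refine tendsto_const_nhds.congr' ?_
  filter_upwards [eventually_ge_atTop (s.sup id + 1)] with n hn
  refine Finset.prod_subset (fun j hj => ?_) fun j _ hj => hs j hj
  have : j ≤ s.sup id := Finset.le_sup (f := id) hj
  simp only [Finset.mem_range]; omega

lemma seqProd_eq_zero {w : ℕ → ℝ≥0∞} (j : ℕ) (hj : w j = 0) : seqProd w = 0 :=
  le_antisymm ((iInf_le _ (j + 1)).trans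
    (Finset.prod_eq_zero (Finset.mem_range.2 j.lt_succ_self) hj).le) bot_le

lemma seqProd_mul {u w : ℕ → ℝ≥0∞} (hu : ∀ j, u j ≤ 1) (hw : ∀ j, w j ≤ 1) :
    seqProd (fun j => u j * w j) = seqProd u * seqProd w := by
  refine tendsto_nhds_unique (tendsto_seqProd fun j => mul_le_one' (hu j) (hw j)) ?_
  simp only [Finset.prod_mul_distrib]
  exact ENNReal.Tendsto.mul (tendsto_seqProd hu)
    (.inr ((seqProd_le_one w).trans_lt ENNReal.one_lt_top).ne) (tendsto_seqProd hw)
    (.inr ((seqProd_le_one u).trans_lt ENNReal.one_lt_top).ne)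

lemma measurable_seqProd {β : Type*} [MeasurableSpace β] {w : ℕ → β → ℝ≥0∞}
    (h : ∀ j, Measurable (w j)) : Measurable fun b => seqProd fun j => w j b :=
  .iInf fun _ => Finset.measurable_prod _ fun j _ => h j

/-- A sequence of infinite products, all but finitely many factors of which are `1` or become
equal to a limit, converges when the finite partial products do, provided it decreases. -/
lemma tendsto_seqProd_of_antitone {w : ℕ → ℕ → ℝ≥0∞} {w' : ℕ → ℝ≥0∞}
    (hanti : ∀ j, Antitone fun n => w n j)
    (hlim : ∀ j, ∀ᶠ n in atTop, w n j = w' j) :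
    Tendsto (fun n => seqProd (w n)) atTop (𝓝 (seqProd w')) := by
  have hle : ∀ n j, w' j ≤ w n j := fun n j => by
    obtain ⟨m, hm, hnm⟩ := ((hlim j).and (eventually_ge_atTop n)).exists
    exact hm ▸ hanti j hnm
  -- Both limits are infima. Any initial segment of `w'` is attained exactly at some `n`, so no
  -- truncation of `w'` lies below the infimum over `n`.
  have key : seqProd w' = ⨅ n, seqProd (w n) := by
    refine le_antisymm (le_iInf fun n => iInf_mono fun m =>
      Finset.prod_le_prod' fun j _ => hle n j) (le_iInf fun m => ?_)
    have : ∀ᶠ n in atTop, ∀ j ∈ Finset.range m, w n j = w' j :=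
      (Finset.range m).eventually_all.2 fun j _ => hlim j
    obtain ⟨n, hn⟩ := this.exists
    exact (iInf_le _ n).trans ((iInf_le _ m).trans (Finset.prod_congr rfl hn).le)
  rw [key]
  exact tendsto_atTop_iInf fun a b hab => iInf_mono fun m =>
    Finset.prod_le_prod' fun j _ => hanti j hab

/-! ### Counts of a Poisson process and multiplicative functionals in a bounded window. -/

section Poisson

lemma lintegral_poissonMeasure (m : NNReal) (φ : ℕ → ℝ≥0∞) :
    ∫⁻ n, φ n ∂poissonMeasure m =
      ∑' n, ENNReal.ofReal (Real.exp (-m) * m ^ n / n.factorial) * φ n := by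
  simp [poissonMeasure, lintegral_sum_measure]

lemma lintegral_pow_poissonMeasure (m : NNReal) {c : ℝ} (hc : 0 ≤ c) :
    ∫⁻ n, ENNReal.ofReal c ^ n ∂poissonMeasure m =
      ENNReal.ofReal (Real.exp (-(m * (1 - c)))) := by
  rw [lintegral_poissonMeasure]
  have h : HasSum (fun n : ℕ => Real.exp (-m) * m ^ n / n.factorial * c ^ n)
      (Real.exp (-(m * (1 - c)))) := by
    have := (NormedSpace.expSeries_div_hasSum_exp (m * c : ℝ)).mul_left (Real.exp (-m))
    rw [← Real.exp_eq_exp_ℝ, ← Real.exp_add] at this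
    convert! this using 1
    · ext n; rw [mul_pow]; ring
    · congr 1; ring
  rw [← h.tsum_eq, ENNReal.ofReal_tsum_of_nonneg (fun n => by positivity) h.summable]
  congr 1; ext n
  rw [ENNReal.ofReal_mul (by positivity), ENNReal.ofReal_pow hc]

variable {Ω : Type*} [MeasurableSpace Ω] {P : Measure Ω} {lam : ℝ} {X : ℕ → Ω → Plane}

lemma IsHomogeneousPPP.lintegral_count (h : IsHomogeneousPPP P lam X) {A : Set Plane}
    (hA : MeasurableSet A) (hA' : volume A ≠ ⊤) (φ : ℕ → ℝ≥0∞) :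
    ∫⁻ ω, φ (count (fun i => X i ω) A) ∂P =
      ∫⁻ n, φ n ∂poissonMeasure (lam * volume.real A).toNNReal :=
  (h.poisson A hA hA').lintegral_comp (measurable_of_countable φ).aemeasurable

lemma IsHomogeneousPPP.lintegral_pow_count (h : IsHomogeneousPPP P lam X) (hlam : 0 ≤ lam)
    {A : Set Plane} (hA : MeasurableSet A) (hA' : volume A ≠ ⊤) {c : ℝ} (hc : 0 ≤ c) :
    ∫⁻ ω, ENNReal.ofReal c ^ count (fun i => X i ω) A ∂P =
      ENNReal.ofReal (Real.exp (-(lam * volume.real A * (1 - c)))) := by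
  rw [h.lintegral_count hA hA' fun n => ENNReal.ofReal c ^ n, lintegral_pow_poissonMeasure _ hc,
    Real.coe_toNNReal _ (by positivity)]

lemma IsHomogeneousPPP.lintegral_count_eq_one (h : IsHomogeneousPPP P lam X) (hlam : 0 ≤ lam)
    {A : Set Plane} (hA : MeasurableSet A) (hA' : volume A ≠ ⊤) :
    ∫⁻ ω, (if count (fun i => X i ω) A = 1 then 1 else 0 : ℝ≥0∞) ∂P =
      ENNReal.ofReal (lam * volume.real A * Real.exp (-(lam * volume.real A))) := by
  rw [h.lintegral_count hA hA' fun n => if n = 1 then 1 else 0, lintegral_poissonMeasure,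
    tsum_eq_single 1 (by intro n hn; simp [hn]), Real.coe_toNNReal _ (by positivity)]
  simp [mul_comm]

/-- The counts are only known to be a.e. measurable, through their laws, so the product rule is
applied to measurable modifications of them. -/
lemma IsHomogeneousPPP.lintegral_prod_count (h : IsHomogeneousPPP P lam X) {ι : Type*} [Fintype ι]
    {A : ι → Set Plane} (hA : ∀ s, MeasurableSet (A s)) (hA' : ∀ s, volume (A s) ≠ ⊤)
    (hd : ∀ s t, s ≠ t → Disjoint (A s) (A t)) (φ : ι → ℕ → ℝ≥0∞) :
    ∫⁻ ω, ∏ s, φ s (count (fun i => X i ω) (A s)) ∂P =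
      ∏ s, ∫⁻ ω, φ s (count (fun i => X i ω) (A s)) ∂P := by
  have e := Fintype.equivFin ι
  have hi := h.indep _ (fun k => A (e.symm k)) (fun _ => hA _) (fun _ => hA' _)
    (fun s t hst => hd _ _ (e.symm.injective.ne hst))
  have hi' : iIndepFun (fun s ω => count (fun i => X i ω) (A s)) P := by
    simpa using hi.precomp e.injective
  have hm : ∀ s, AEMeasurable (fun ω => count (fun i => X i ω) (A s)) P :=
    fun s => (h.poisson _ (hA s) (hA' s)).aemeasurable
  have hi'' := (hi'.congr fun s => (hm s).ae_eq_mk).comp φ fun s => measurable_of_countable _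
  have := lintegral_prod_eq_prod_lintegral_of_indepFun Finset.univ _ hi'' fun s =>
    (measurable_of_countable (φ s)).comp (hm s).measurable_mk
  have hall : ∀ᵐ ω ∂P, ∀ s, count (fun i => X i ω) (A s) = (hm s).mk _ ω :=
    ae_all_iff.2 fun s => (hm s).ae_eq_mk
  refine Eq.trans ?_ (this.trans ?_)
  · refine lintegral_congr_ae ?_
    filter_upwards [hall] with ω hω
    simp only [Function.comp_apply, hω]
  · refine Finset.prod_congr rfl fun s _ => lintegral_congr_ae ?_
    filter_upwards [hall] with ω hω
    simp only [Function.comp_apply, hω]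

/-- Grouping the finitely many points of `B` by the value of `w` turns the product into powers of
the values, with counts of level sets as exponents. The independence of counts can then be applied.
-/
lemma seqProd_simpleFunc {x : ℕ → Plane} {B : Set Plane} (hB : {i | x i ∈ B}.Finite)
    (w : SimpleFunc Plane ℝ) (hw : ∀ y, w y ≤ 1) (hwB : ∀ y ∉ B, w y = 1) :
    seqProd (fun j => ENNReal.ofReal (w (x j))) =
      ∏ c ∈ w.range, ENNReal.ofReal c ^ count x (B ∩ w ⁻¹' {c}) := by
  classical
  rw [seqProd_eq_prod (fun j => by simpa using hw (x j)) hB.toFinset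
    (fun j hj => by rw [hwB _ (by simpa using hj)]; simp),
    ← Finset.prod_fiberwise_of_maps_to (t := w.range) (g := fun j => w (x j))
      (fun j _ => w.mem_range_self _)]
  refine Finset.prod_congr rfl fun c _ => ?_
  rw [Finset.prod_congr rfl (g := fun _ => ENNReal.ofReal c)
    (fun j hj => by rw [(Finset.mem_filter.1 hj).2]), Finset.prod_const, count,
    ← Set.ncard_coe_finset]
  congr 2
  ext j; simp

lemma IsHomogeneousPPP.lintegral_count_mul_simpleFunc (h : IsHomogeneousPPP P lam X)
    (hlam : 0 ≤ lam) {A B : Set Plane} (hA : MeasurableSet A) (hA' : volume A ≠ ⊤)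
    (hB : MeasurableSet B) (hB' : volume B ≠ ⊤) (hAB : Disjoint A B) (φ : ℕ → ℝ≥0∞)
    (w : SimpleFunc Plane ℝ) (hw : ∀ y, w y ∈ Set.Icc (0 : ℝ) 1) (hwB : ∀ y ∉ B, w y = 1) :
    ∫⁻ ω, φ (count (fun i => X i ω) A) * seqProd (fun j => ENNReal.ofReal (w (X j ω))) ∂P =
      (∫⁻ ω, φ (count (fun i => X i ω) A) ∂P) *
        ENNReal.ofReal (Real.exp (-(lam * ∫ y, (1 - w y)))) := by
  have hatom : ∀ c, MeasurableSet (B ∩ w ⁻¹' {c}) := fun c => hB.inter (w.measurableSet_fiber c)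
  have hatom' : ∀ c, volume (B ∩ w ⁻¹' {c}) ≠ ⊤ :=
    fun c => measure_ne_top_of_subset Set.inter_subset_left hB'
  have hI : ∫ y, (1 - w y) = ∑ c ∈ w.range, volume.real (B ∩ w ⁻¹' {c}) * (1 - c) := by
    have : ∀ y, 1 - w y = ∑ c ∈ w.range, (B ∩ w ⁻¹' {c}).indicator (fun _ => 1 - c) y := by
      intro y
      by_cases hy : y ∈ B
      · rw [Finset.sum_eq_single (w y)]
        · rw [Set.indicator_of_mem (by simp [hy])]
        · intro c _ hc
          exact Set.indicator_of_notMem (by simp [hc.symm]) _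
        · intro hn; exact absurd (w.mem_range_self y) hn
      · rw [Finset.sum_eq_zero, hwB y hy, sub_self]
        intro c _
        exact Set.indicator_of_notMem (by simp [hy]) _
    simp_rw [this]
    rw [integral_finsetSum]
    · refine Finset.sum_congr rfl fun c _ => ?_
      rw [integral_indicator_const _ (hatom c), smul_eq_mul]
    · intro c _
      exact (integrable_indicator_iff (hatom c)).2 (integrableOn_const (hatom' c))
  -- One disjoint family holds both `A` (at `none`) and the level sets of `w` in `B`, so that a
  -- single use of independence separates all of them.
  let A' : Option w.range → Set Plane := fun o => o.elim A fun c => B ∩ w ⁻¹' {c.1}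
  let φ' : Option w.range → ℕ → ℝ≥0∞ := fun o => o.elim φ fun c n => ENNReal.ofReal c.1 ^ n
  have hprod := h.lintegral_prod_count (A := A') (φ := φ')
    (by rintro (_ | c); exacts [hA, hatom c]) (by rintro (_ | c); exacts [hA', hatom' c])
    (by
      rintro (_ | c) (_ | d) hcd
      · exact absurd rfl hcd
      · exact hAB.mono_right Set.inter_subset_left
      · exact (hAB.mono_right Set.inter_subset_left).symm
      · refine Set.disjoint_left.2 fun y hy hy' => hcd ?_
        have h1 : w y = c := hy.2
        have h2 : w y = d := hy'.2
        exact congrArg some (Subtype.ext (h1.symm.trans h2)))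
  simp only [Fintype.prod_option, A', φ', Option.elim] at hprod
  have hfin : ∀ᵐ ω ∂P, φ (count (fun i => X i ω) A) *
      seqProd (fun j => ENNReal.ofReal (w (X j ω))) = φ (count (fun i => X i ω) A) *
      ∏ c : w.range, ENNReal.ofReal c.1 ^ count (fun i => X i ω) (B ∩ w ⁻¹' {c.1}) := by
    filter_upwards [h.finite B hB hB'] with ω hω
    rw [seqProd_simpleFunc hω w (fun y => (hw y).2) hwB, ← Finset.prod_coe_sort]
  rw [lintegral_congr_ae hfin, hprod, hI]
  congr 1
  rw [Finset.mul_sum, ← Finset.sum_neg_distrib, Real.exp_sum,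
    ENNReal.ofReal_prod_of_nonneg (fun _ _ => by positivity)]
  refine .trans (Finset.prod_congr rfl fun c _ => ?_) (Finset.prod_coe_sort w.range fun c =>
    ENNReal.ofReal (Real.exp (-(lam * (volume.real (B ∩ w ⁻¹' {c}) * (1 - c))))))
  have hc : 0 ≤ c.1 := by
    obtain ⟨y, hy⟩ := SimpleFunc.mem_range.1 c.2
    exact hy ▸ (hw y).1
  rw [h.lintegral_pow_count hlam (hatom c) (hatom' c) hc, mul_assoc]

/-- Joint law of the number of points in `A` and of a multiplicative functional of the points in
a disjoint set `B`. -/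
lemma IsHomogeneousPPP.lintegral_count_mul_seqProd [IsProbabilityMeasure P]
    (h : IsHomogeneousPPP P lam X)
    (hlam : 0 ≤ lam) {A B : Set Plane} (hA : MeasurableSet A) (hA' : volume A ≠ ⊤)
    (hB : MeasurableSet B) (hB' : volume B ≠ ⊤) (hAB : Disjoint A B) {φ : ℕ → ℝ≥0∞}
    (hφ : ∀ n, φ n ≤ 1) {w : Plane → ℝ} (hm : Measurable w)
    (hw : ∀ y, w y ∈ Set.Icc (0 : ℝ) 1) (hwB : ∀ y ∉ B, w y = 1) :
    ∫⁻ ω, φ (count (fun i => X i ω) A) * seqProd (fun j => ENNReal.ofReal (w (X j ω))) ∂P =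
      (∫⁻ ω, φ (count (fun i => X i ω) A) ∂P) *
        ENNReal.ofReal (Real.exp (-(lam * ∫ y, (1 - w y)))) := by
  have h1 : (1 : ℝ) ∈ Set.Icc (0 : ℝ) 1 := by simp
  let u : ℕ → SimpleFunc Plane ℝ := SimpleFunc.approxOn w hm (Set.Icc 0 1) 1 h1
  have hu : ∀ n y, u n y ∈ Set.Icc (0 : ℝ) 1 := SimpleFunc.approxOn_mem hm h1
  -- An approximant is never farther from `w y` than the base point 1, so taking 1 as base point
  -- makes it exact where `w` is 1.
  have huB : ∀ n, ∀ y ∉ B, u n y = 1 := fun n y hy => by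
    have := SimpleFunc.edist_approxOn_le hm h1 y n
    rw [hwB y hy, edist_self, nonpos_iff_eq_zero, edist_eq_zero] at this
    exact this
  have hlim : ∀ y, Tendsto (fun n => u n y) atTop (𝓝 (w y)) := fun y =>
    SimpleFunc.tendsto_approxOn hm h1 (subset_closure (hw y))
  have hcm : AEMeasurable (fun ω => φ (count (fun i => X i ω) A)) P :=
    (measurable_of_countable φ).comp_aemeasurable (h.poisson A hA hA').aemeasurable
  refine tendsto_nhds_unique (f := fun n => ∫⁻ ω, φ (count (fun i => X i ω) A) *
    seqProd (fun j => ENNReal.ofReal (u n (X j ω))) ∂P) (l := atTop) ?_ ?_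
  · refine tendsto_lintegral_of_dominated_convergence' (fun _ => 1) (fun n => ?_) (fun n => ?_)
      (by simp) ?_
    · exact hcm.mul (measurable_seqProd fun j =>
        ((u n).measurable.comp (h.measurable j)).ennreal_ofReal).aemeasurable
    · exact .of_forall fun ω => mul_le_one' (hφ _) (seqProd_le_one _)
    · filter_upwards [h.finite B hB hB'] with ω hω
      refine ENNReal.Tendsto.const_mul ?_ (.inr ((hφ _).trans_lt ENNReal.one_lt_top).ne)
      have e : ∀ f : Plane → ℝ, (∀ y, f y ∈ Set.Icc (0 : ℝ) 1) → (∀ y ∉ B, f y = 1) →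
          seqProd (fun j => ENNReal.ofReal (f (X j ω))) =
            ∏ j ∈ hω.toFinset, ENNReal.ofReal (f (X j ω)) := fun f hf hfB =>
        seqProd_eq_prod (fun j => by simpa using (hf _).2) _
          (fun j hj => by rw [hfB _ (by simpa using hj)]; simp)
      simp_rw [e _ (hu _) (huB _), e _ hw hwB]
      refine ENNReal.tendsto_finsetProd_of_ne_top _ (fun j _ => ?_) fun _ _ => ENNReal.ofReal_ne_top
      exact ENNReal.tendsto_ofReal (hlim _)
  · simp_rw [fun n => h.lintegral_count_mul_simpleFunc hlam hA hA' hB hB' hAB φ (u n) (hu n) (huB n)]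
    refine ENNReal.Tendsto.const_mul (ENNReal.tendsto_ofReal ?_) (.inl ?_)
    · refine (Real.continuous_exp.tendsto _).comp (Tendsto.neg (Tendsto.const_mul _ ?_))
      refine tendsto_integral_of_dominated_convergence (B.indicator fun _ => 1)
        (fun n => ((measurable_const.sub (u n).measurable)).aestronglyMeasurable)
        ((integrable_indicator_iff hB).2 (integrableOn_const hB')) (fun n => .of_forall fun y => ?_)
        (.of_forall fun y => (hlim y).const_sub 1)
      by_cases hy : y ∈ B
      · rw [Set.indicator_of_mem hy, Real.norm_eq_abs, abs_le]
        have := hu n y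
        constructor <;> linarith [this.1, this.2]
      · rw [Set.indicator_of_notMem hy, huB n y hy]; simp
    · exact (Real.exp_pos _ |> ENNReal.ofReal_pos.2).ne'

end Poisson

/-! ### The probability generating functional on the whole plane. -/

section Functional

variable {Ω : Type*} [MeasurableSpace Ω] {P : Measure Ω} {lam : ℝ} {X : ℕ → Ω → Plane}

/-- Probability generating functional of a homogeneous Poisson point process. -/
theorem IsHomogeneousPPP.lintegral_seqProd [IsProbabilityMeasure P]
    (h : IsHomogeneousPPP P lam X) (hlam : 0 ≤ lam) {w : Plane → ℝ} (hm : Measurable w)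
    (hw : ∀ y, w y ∈ Set.Icc (0 : ℝ) 1) (hint : Integrable fun y => 1 - w y) :
    ∫⁻ ω, seqProd (fun j => ENNReal.ofReal (w (X j ω))) ∂P =
      ENNReal.ofReal (Real.exp (-(lam * ∫ y, (1 - w y)))) := by
  classical
  let u : ℕ → Plane → ℝ := fun n y => if ‖y‖ ≤ n then w y else 1
  have hum : ∀ n, Measurable (u n) := fun n =>
    hm.ite (measurableSet_le measurable_norm measurable_const) measurable_const
  have hu : ∀ n y, u n y ∈ Set.Icc (0 : ℝ) 1 := fun n y => by
    simp only [u]; split_ifs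
    exacts [hw y, by simp]
  have hev : ∀ y, ∀ᶠ n in atTop, u n y = w y := fun y => by
    filter_upwards [eventually_ge_atTop ⌈‖y‖⌉₊] with n hn
    exact if_pos (Nat.ceil_le.1 hn)
  have hstep : ∀ n, ∫⁻ ω, seqProd (fun j => ENNReal.ofReal (u n (X j ω))) ∂P =
      ENNReal.ofReal (Real.exp (-(lam * ∫ y, (1 - u n y)))) := fun n => by
    simpa using h.lintegral_count_mul_seqProd hlam (A := ∅) MeasurableSet.empty (by simp)
      (B := Metric.closedBall 0 n) Metric.isClosed_closedBall.measurableSet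
      measure_closedBall_lt_top.ne (by simp) (φ := fun _ => 1) (fun _ => le_rfl) (hum n) (hu n)
      (fun y hy => if_neg (by simpa using hy))
  refine tendsto_nhds_unique (f := fun n => ∫⁻ ω, seqProd (fun j =>
    ENNReal.ofReal (u n (X j ω))) ∂P) (l := atTop) ?_ ?_
  · refine tendsto_lintegral_of_dominated_convergence (fun _ => 1)
      (fun n => measurable_seqProd fun j => ((hum n).comp (h.measurable j)).ennreal_ofReal)
      (fun n => .of_forall fun ω => seqProd_le_one _) (by simp) (.of_forall fun ω => ?_)
    refine tendsto_seqProd_of_antitone (fun j a b hab => ENNReal.ofReal_le_ofReal ?_)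
      fun j => (hev _).mono fun n hn => by rw [hn]
    simp only [u]
    split_ifs with h1 h2 h2
    · exact le_rfl
    · exact (hw _).2
    · exact absurd (h2.trans (Nat.cast_le.2 hab)) h1
    · exact le_rfl
  · simp_rw [hstep]
    refine ENNReal.tendsto_ofReal ((Real.continuous_exp.tendsto _).comp
      (Tendsto.neg (Tendsto.const_mul _ ?_)))
    refine tendsto_integral_of_dominated_convergence (fun y => 1 - w y)
      (fun n => (measurable_const.sub (hum n)).aestronglyMeasurable) hint
      (fun n => .of_forall fun y => ?_) (.of_forall fun y => ?_)
    · have := hw y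
      simp only [u]; split_ifs
      · rw [Real.norm_of_nonneg (by linarith [this.2])]
      · simpa using this.2
    · exact tendsto_const_nhds.congr' ((hev y).mono fun n hn => by simp only [hn])

/-! ### The closest point, and functionals of the process seen from it. -/

/-- Index of a point of the sequence `x` closest to the origin. -/
def nearest (x : ℕ → Plane) : ℕ := sInf {i | ∀ j, ‖x i‖ ≤ ‖x j‖}

lemma norm_nearest_le {x : ℕ → Plane} (hx : {i | x i ∈ Metric.closedBall 0 ‖x 0‖}.Finite)
    (j : ℕ) : ‖x (nearest x)‖ ≤ ‖x j‖ := by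
  have hne : {i | ∀ j, ‖x i‖ ≤ ‖x j‖}.Nonempty := by
    obtain ⟨i, hi, hmin⟩ := hx.exists_minimalFor (fun i => ‖x i‖) _ ⟨0, by simp⟩
    refine ⟨i, fun j => ?_⟩
    rcases le_total ‖x i‖ ‖x j‖ with hij | hij
    · exact hij
    · exact hmin (by simpa using hij.trans (by simpa using hi)) hij
  exact Nat.sInf_mem hne j

lemma measurable_nearest : Measurable nearest := by
  have hS : ∀ i, MeasurableSet {x : ℕ → Plane | ∀ j, ‖x i‖ ≤ ‖x j‖} := fun i => by
    rw [Set.ofPred_forall]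
    exact .iInter fun j => measurableSet_le (by fun_prop) (by fun_prop)
  refine measurable_to_countable' fun i => ?_
  -- The second piece accounts for sequences without a closest point, where `sInf ∅ = 0`.
  have : nearest ⁻¹' {i} = ({x | ∀ j, ‖x i‖ ≤ ‖x j‖} ∩ ⋂ k < i, {x | ∀ j, ‖x k‖ ≤ ‖x j‖}ᶜ) ∪
      ({_x | i = 0} ∩ ⋂ k, {x | ∀ j, ‖x k‖ ≤ ‖x j‖}ᶜ) := by
    ext x
    simp only [Set.mem_preimage, Set.mem_singleton_iff, Set.mem_union, Set.mem_inter_iff,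
      Set.mem_iInter, Set.mem_compl_iff, Set.mem_ofPred_eq (p := fun x : ℕ → Plane => _)]
    constructor
    · rintro rfl
      by_cases hne : {i | ∀ j, ‖x i‖ ≤ ‖x j‖}.Nonempty
      · exact .inl ⟨Nat.sInf_mem hne, fun k hk => Nat.notMem_of_lt_sInf hk⟩
      · rw [Set.not_nonempty_iff_eq_empty] at hne
        refine .inr ⟨by simp [nearest, hne], fun k hk => ?_⟩
        have : k ∈ {i | ∀ j, ‖x i‖ ≤ ‖x j‖} := hk
        simp [hne] at this
    · rintro (⟨h1, h2⟩ | ⟨rfl, h2⟩)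
      · refine le_antisymm (Nat.sInf_le h1) (le_of_not_gt fun hlt => ?_)
        exact h2 _ hlt (Nat.sInf_mem (s := {i | ∀ j, ‖x i‖ ≤ ‖x j‖}) ⟨i, h1⟩)
      · have : {i | ∀ j, ‖x i‖ ≤ ‖x j‖} = ∅ := Set.eq_empty_of_forall_notMem h2
        simp [nearest, this]
  rw [this]
  exact ((hS i).inter (.iInter fun k => .iInter fun _ => (hS k).compl)).union
    ((MeasurableSet.const _).inter (.iInter fun k => (hS k).compl))

lemma IsHomogeneousPPP.ae_finite (h : IsHomogeneousPPP P lam X) :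
    ∀ᵐ ω ∂P, ∀ R : ℝ, {i | X i ω ∈ Metric.closedBall 0 R}.Finite := by
  have : ∀ᵐ ω ∂P, ∀ n : ℕ, {i | X i ω ∈ Metric.closedBall 0 (n : ℝ)}.Finite :=
    ae_all_iff.2 fun n => h.finite _ Metric.isClosed_closedBall.measurableSet
      measure_closedBall_lt_top.ne
  filter_upwards [this] with ω hω R
  obtain ⟨n, hn⟩ := exists_nat_ge R
  exact (hω n).subset fun i hi => Metric.closedBall_subset_closedBall hn hi

lemma IsHomogeneousPPP.ae_norm_tagged_le (h : IsHomogeneousPPP P lam X) :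
    ∀ᵐ ω ∂P, ∀ j, ‖X (tagged X ω) ω‖ ≤ ‖X j ω‖ := by
  filter_upwards [h.ae_finite] with ω hω
  exact norm_nearest_le (x := fun i => X i ω) (hω _)

lemma measurable_tagged (hX : ∀ i, Measurable (X i)) : Measurable (tagged X) :=
  measurable_nearest.comp (measurable_pi_lambda _ hX)

lemma measurable_tagged_point (hX : ∀ i, Measurable (X i)) :
    Measurable fun ω => X (tagged X ω) ω := by
  have : Measurable fun q : ℕ × Ω => X q.1 q.2 := measurable_from_prod_countable_right hX
  exact this.comp ((measurable_tagged hX).prodMk measurable_id)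

/-- The product of `G (X_τ, X_j)` over all points other than the one, `X_τ`, closest to the
origin. -/
def palmProd (X : ℕ → Ω → Plane) (G : Plane → Plane → ℝ) (ω : Ω) : ℝ≥0∞ :=
  seqProd fun j => if j = tagged X ω then 1 else ENNReal.ofReal (G (X (tagged X ω) ω) (X j ω))

lemma measurable_palmProd (hX : ∀ i, Measurable (X i)) {G : Plane → Plane → ℝ}
    (hG : Measurable (Function.uncurry G)) : Measurable (palmProd X G) := by
  refine measurable_seqProd fun j => Measurable.ite ?_ measurable_const ?_
  · exact measurableSet_eq_fun measurable_const (measurable_tagged hX)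
  · exact (hG.comp ((measurable_tagged_point hX).prodMk (hX j))).ennreal_ofReal

/-- The vanishing of `w` does the bookkeeping. If `x τ` is in `A`, a second point of `A` would put a
zero factor on the left. If the only point of `A` were not `x τ`, then `x τ`, being at most as far
out, would put a zero factor on the right. In the remaining case the factors agree one by one. -/
lemma indicator_palmProd_eq {x : ℕ → Plane} {τ : ℕ} (hτ : ∀ j, ‖x τ‖ ≤ ‖x j‖) {A : Set Plane}
    [DecidablePred (· ∈ A)] {w : Plane → ℝ} (hA : ∀ a ∈ A, ∀ y, ‖y‖ ≤ ‖a‖ → w y = 0) :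
    (if x τ ∈ A then seqProd (fun j => if j = τ then 1 else ENNReal.ofReal (w (x j))) else 0) =
      (if count x A = 1 then 1 else 0) *
        seqProd (fun j => ENNReal.ofReal (if x j ∈ A then 1 else w (x j))) := by
  by_cases hmem : x τ ∈ A
  · rw [if_pos hmem]
    by_cases hex : ∃ j, j ≠ τ ∧ x j ∈ A
    · obtain ⟨j, hj, hjA⟩ := hex
      rw [seqProd_eq_zero j (by rw [if_neg hj, hA _ hjA _ le_rfl]; simp), if_neg, zero_mul]
      intro hc
      obtain ⟨a, ha⟩ := Set.ncard_eq_one.1 hc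
      have h1 : τ ∈ ({a} : Set ℕ) := ha ▸ hmem
      have h2 : j ∈ ({a} : Set ℕ) := ha ▸ hjA
      exact hj (h2.trans h1.symm)
    · push Not at hex
      have hset : {i | x i ∈ A} = {τ} := by
        ext j
        refine ⟨fun hj => ?_, fun hj => ?_⟩
        · by_contra hne
          exact hex j hne hj
        · rw [Set.mem_singleton_iff] at hj
          exact hj ▸ hmem
      rw [if_pos (by rw [count, hset, Set.ncard_singleton]), one_mul]
      congr 1; ext j
      by_cases hj : j = τ
      · simp [hj, hmem]
      · simp [hj, hex j hj]
  · rw [if_neg hmem]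
    split_ifs with hc
    · obtain ⟨a, ha⟩ := Set.ncard_eq_one.1 hc
      have haA : x a ∈ A := by
        have : a ∈ {i | x i ∈ A} := ha ▸ rfl
        exact this
      rw [seqProd_eq_zero τ (by rw [if_neg hmem, hA _ haA _ (hτ a)]; simp), mul_zero]
    · rw [zero_mul]

lemma integrable_one_sub {w : Plane → ℝ} (hm : Measurable w) (hw : ∀ y, w y ∈ Set.Icc (0 : ℝ) 1)
    {B : Set Plane} (hB : MeasurableSet B) (hB' : volume B ≠ ⊤) (hwB : ∀ y ∉ B, w y = 1) :
    Integrable fun y => 1 - w y := by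
  refine Integrable.mono' (g := B.indicator fun _ => 1)
    ((integrable_indicator_iff hB).2 (integrableOn_const hB'))
    (measurable_const.sub hm).aestronglyMeasurable (.of_forall fun y => ?_)
  by_cases hy : y ∈ B
  · rw [Set.indicator_of_mem hy, Real.norm_eq_abs, abs_le]
    have := hw y
    constructor <;> linarith [this.1, this.2]
  · rw [Set.indicator_of_notMem hy, hwB y hy]; simp

-- "Exactly one point in `A`" has probability λ|A|·exp(-λ|A|) and is independent of the points
-- outside `A`, whose generating functional supplies the other exponential. The formula is exact for
-- each cell `A`, not only in the limit of small cells.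
open Classical in
lemma IsHomogeneousPPP.lintegral_tagged_mem [IsProbabilityMeasure P]
    (h : IsHomogeneousPPP P lam X) (hlam : 0 ≤ lam) {A : Set Plane} (hA : MeasurableSet A)
    {w : Plane → ℝ} (hm : Measurable w) (hw : ∀ y, w y ∈ Set.Icc (0 : ℝ) 1)
    {B : Set Plane} (hB : MeasurableSet B) (hB' : volume B ≠ ⊤) (hwB : ∀ y ∉ B, w y = 1)
    (hAw : ∀ a ∈ A, ∀ y, ‖y‖ ≤ ‖a‖ → w y = 0) :
    ∫⁻ ω, (if X (tagged X ω) ω ∈ A then palmProd X (fun _ => w) ω else 0) ∂P =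
      ENNReal.ofReal (lam * Real.exp (-(lam * ∫ y, (1 - w y)))) * volume A := by
  have hAB : A ⊆ B := fun a ha => by
    by_contra haB
    have h0 := hAw a ha a le_rfl
    rw [hwB a haB] at h0
    exact one_ne_zero h0
  have hA' : volume A ≠ ⊤ := measure_ne_top_of_subset hAB hB'
  have hum : Measurable fun y => if y ∈ A then 1 else w y := measurable_const.ite hA hm
  have hu : ∀ y, (if y ∈ A then 1 else w y) ∈ Set.Icc (0 : ℝ) 1 := fun y => by
    split_ifs
    exacts [by simp, hw y]
  have huB : ∀ y ∉ B \ A, (if y ∈ A then 1 else w y) = 1 := fun y hy => by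
    split_ifs with hyA
    · rfl
    · exact hwB y fun hyB => hy ⟨hyB, hyA⟩
  have hpt : ∀ᵐ ω ∂P, (if X (tagged X ω) ω ∈ A then palmProd X (fun _ => w) ω else 0) =
      (if count (fun i => X i ω) A = 1 then 1 else 0) *
        seqProd (fun j => ENNReal.ofReal (if X j ω ∈ A then 1 else w (X j ω))) := by
    filter_upwards [h.ae_norm_tagged_le] with ω hω
    exact indicator_palmProd_eq (x := fun j => X j ω) hω hAw
  -- As `w` is 0 on `A`, the set contributes its full area to the integral; this absorbs the factor
  -- exp(-λ|A|).
  have hint : ∫ y, (1 - w y) = volume.real A + ∫ y, (1 - if y ∈ A then 1 else w y) := by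
    have hA1 : Integrable (A.indicator (1 : Plane → ℝ)) :=
      (integrable_indicator_iff hA).2 (integrableOn_const hA')
    rw [← integral_indicator_one hA, ← integral_add hA1 (integrable_one_sub hum hu (hB.diff hA)
        (measure_ne_top_of_subset Set.sdiff_subset hB') huB)]
    congr 1; ext y
    by_cases hy : y ∈ A
    · simp [hy, hAw y hy y le_rfl]
    · simp [hy]
  rw [lintegral_congr_ae hpt, h.lintegral_count_mul_seqProd hlam hA hA' (hB.diff hA)
    (measure_ne_top_of_subset Set.sdiff_subset hB') Set.disjoint_sdiff_right
    (φ := fun n => if n = 1 then 1 else 0) (fun n => by split_ifs <;> simp) hum hu huB,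
    h.lintegral_count_eq_one hlam hA hA', hint, ← ENNReal.ofReal_mul (by positivity),
    ← ofReal_measureReal hA', ← ENNReal.ofReal_mul (by positivity)]
  congr 1
  rw [mul_add, neg_add, Real.exp_add]
  ring

-- On each cell where the label `k` is constant the kernel no longer depends on the closest point,
-- so the fixed-weight formula applies there. Summing over the countably many cells rebuilds the
-- integral over `B`.
open Classical in
lemma IsHomogeneousPPP.lintegral_palmProd_of_countable [IsProbabilityMeasure P]
    (h : IsHomogeneousPPP P lam X) (hlam : 0 ≤ lam) {K : Type*} [Countable K] [MeasurableSpace K]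
    [DiscreteMeasurableSpace K] {k : Plane → K} (hk : Measurable k) {w : K → Plane → ℝ}
    (hm : ∀ a, Measurable (w a)) (hw : ∀ a y, w a y ∈ Set.Icc (0 : ℝ) 1)
    {B : Set Plane} (hB : MeasurableSet B) (hB' : volume B ≠ ⊤) (hwB : ∀ a, ∀ y ∉ B, w a y = 1)
    (hkw : ∀ x ∈ B, ∀ y, ‖y‖ ≤ ‖x‖ → w (k x) y = 0) :
    ∫⁻ ω, (if X (tagged X ω) ω ∈ B then palmProd X (fun x => w (k x)) ω else 0) ∂P =
      ∫⁻ x in B, ENNReal.ofReal (lam * Real.exp (-(lam * ∫ y, (1 - w (k x) y)))) := by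
  have hcell : ∀ a, MeasurableSet (k ⁻¹' {a} ∩ B) := fun a => (hk (.singleton a)).inter hB
  have hpt : ∀ ω, (if X (tagged X ω) ω ∈ B then palmProd X (fun x => w (k x)) ω else 0) =
      ∑' a, if X (tagged X ω) ω ∈ k ⁻¹' {a} ∩ B then palmProd X (fun _ => w a) ω else 0 := by
    intro ω
    rw [tsum_eq_single (k (X (tagged X ω) ω))]
    · simp only [Set.mem_inter_iff, Set.mem_preimage, Set.mem_singleton_iff, true_and, palmProd]
    · intro a ha
      exact if_neg fun hmem => ha hmem.1.symm
  simp_rw [hpt]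
  rw [lintegral_tsum fun a => Measurable.aemeasurable <| Measurable.ite
    (measurable_tagged_point h.measurable (hcell a)) (measurable_palmProd (G := fun _ => w a)
      h.measurable ((hm a).comp measurable_snd)) measurable_const]
  rw [← lintegral_map (f := fun a => ENNReal.ofReal (lam * Real.exp (-(lam * ∫ y, (1 - w a y)))))
    (measurable_of_countable _) hk, lintegral_countable']
  refine tsum_congr fun a => ?_
  rw [Measure.map_apply hk (.singleton a), Measure.restrict_apply (hk (.singleton a))]
  convert! h.lintegral_tagged_mem hlam (hcell a) (hm a) (hw a) hB hB' (hwB a)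
    fun x hx y hy => by
      have : k x = a := hx.1
      exact this ▸ hkw x hx.2 y hy

/-! ### Discretizing the closest point in a bounded window. -/

/-- The factor `v` restricted to the window of radius `R`, and set to `0` within distance `ρ` of
the origin. -/
def screened (R ρ : ℝ) (v : Plane → ℝ) (y : Plane) : ℝ :=
  if ‖y‖ ≤ R then (if ‖y‖ ≤ ρ then 0 else v y) else 1

lemma screened_mem (R ρ : ℝ) {v : Plane → ℝ} (hv : ∀ y, v y ∈ Set.Icc (0 : ℝ) 1) (y : Plane) :
    screened R ρ v y ∈ Set.Icc (0 : ℝ) 1 := by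
  unfold screened; split_ifs
  exacts [by simp, hv y, by simp]

lemma screened_eq_one {R ρ : ℝ} {v : Plane → ℝ} {y : Plane} (hy : y ∉ Metric.closedBall 0 R) :
    screened R ρ v y = 1 := if_neg (by simpa using hy)

lemma measurable_screened {β : Type*} [MeasurableSpace β] {R : ℝ} {ρ : β → ℝ}
    {v : β → Plane → ℝ} {y : β → Plane} (hρ : Measurable ρ) (hy : Measurable y)
    (hv : Measurable fun b => v b (y b)) : Measurable fun b => screened R (ρ b) (v b) (y b) :=
  (measurable_const.ite (measurableSet_le hy.norm hρ) hv).ite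
    (measurableSet_le hy.norm measurable_const) measurable_const

lemma integrable_one_sub_screened {R ρ : ℝ} {v : Plane → ℝ} (hvm : Measurable v)
    (hv : ∀ y, v y ∈ Set.Icc (0 : ℝ) 1) : Integrable fun y => 1 - screened R ρ v y :=
  integrable_one_sub (measurable_screened measurable_const measurable_id hvm)
    (screened_mem R ρ hv) Metric.isClosed_closedBall.measurableSet measure_closedBall_lt_top.ne
    (fun _ hy => screened_eq_one hy)

lemma measurable_palm_density {G : Plane → Plane → ℝ} (hG : Measurable (Function.uncurry G)) :
    Measurable fun x => ENNReal.ofReal (lam * Real.exp (-(lam * ∫ y, (1 - G x y)))) := by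
  have : Measurable fun x => ∫ y, (1 - G x y) :=
    (StronglyMeasurable.integral_prod_right (ν := volume) (f := fun x y => 1 - G x y)
      (hG.const_sub (1 : ℝ)).stronglyMeasurable).measurable
  fun_prop

/-- Discretization of a point: rounding up of its norm, and a close point of a dense sequence. -/
def gridIndex (n : ℕ) (x : Plane) : ℕ × ℕ :=
  (⌈(n + 1) * ‖x‖⌉₊, SimpleFunc.nearestPtInd (TopologicalSpace.denseSeq Plane) n x)

lemma measurable_gridIndex (n : ℕ) : Measurable (gridIndex n) :=
  (Nat.measurable_ceil.comp (by fun_prop)).prodMk (SimpleFunc.measurable _)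

/-- Upper approximation of the norm from the grid index. -/
def gridNorm (n : ℕ) (a : ℕ × ℕ) : ℝ := a.1 / (n + 1)

lemma norm_le_gridNorm (n : ℕ) (x : Plane) : ‖x‖ ≤ gridNorm n (gridIndex n x) := by
  rw [gridNorm, le_div_iff₀ (by positivity), mul_comm]
  exact Nat.le_ceil _

lemma tendsto_gridNorm (x : Plane) :
    Tendsto (fun n => gridNorm n (gridIndex n x)) atTop (𝓝 ‖x‖) := by
  have h0 : Tendsto (fun n : ℕ => ‖x‖ + 1 / ((n : ℝ) + 1)) atTop (𝓝 ‖x‖) := by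
    simpa using tendsto_const_nhds.add (tendsto_one_div_add_atTop_nhds_zero_nat (𝕜 := ℝ))
  refine tendsto_of_tendsto_of_tendsto_of_le_of_le tendsto_const_nhds h0
    (fun n => norm_le_gridNorm n x) fun n => ?_
  have hn : (0 : ℝ) < n + 1 := by positivity
  have := (Nat.ceil_lt_add_one (a := ((n : ℝ) + 1) * ‖x‖) (by positivity)).le
  simp only [gridNorm, gridIndex]
  rw [div_le_iff₀ hn, add_mul (‖x‖), one_div, inv_mul_cancel₀ hn.ne', mul_comm (‖x‖)]
  exact this

/-- Approximation of a point from the grid index. -/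
def gridPoint (a : ℕ × ℕ) : Plane := TopologicalSpace.denseSeq Plane a.2

lemma tendsto_gridPoint (x : Plane) :
    Tendsto (fun n => gridPoint (gridIndex n x)) atTop (𝓝 x) :=
  SimpleFunc.tendsto_nearestPt (by
    rw [(TopologicalSpace.denseRange_denseSeq Plane).closure_range]; trivial)

/-- The norm is rounded up, so the approximants are already 0 wherever `‖y‖ ≤ ‖x‖`, including on the
discontinuity circle. Beyond it the rounded radius eventually drops below `‖y‖` and continuity of
`v` in `x` takes over. -/
lemma tendsto_screened {R : ℝ} {v : Plane → Plane → ℝ} (hcont : ∀ y, Continuous fun x => v x y)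
    (x y : Plane) :
    Tendsto (fun n => screened R (gridNorm n (gridIndex n x)) (v (gridPoint (gridIndex n x))) y)
      atTop (𝓝 (screened R ‖x‖ (v x) y)) := by
  by_cases hR : ‖y‖ ≤ R
  · by_cases hx : ‖y‖ ≤ ‖x‖
    · have : ∀ n, screened R (gridNorm n (gridIndex n x)) (v (gridPoint (gridIndex n x))) y = 0 :=
        fun n => by rw [screened, if_pos hR, if_pos (hx.trans (norm_le_gridNorm n x))]
      simp_rw [this]
      rw [screened, if_pos hR, if_pos hx]
      exact tendsto_const_nhds
    · simp only [screened, if_pos hR, if_neg hx]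
      refine (((hcont y).tendsto x).comp (tendsto_gridPoint x)).congr' ?_
      filter_upwards [(tendsto_gridNorm x).eventually_lt_const (not_le.1 hx)] with n hn
      rw [if_neg (not_le.2 hn), Function.comp_apply]
  · simp only [screened, if_neg hR, tendsto_const_nhds]

lemma measurable_uncurry_of_countable {K : Type*} [Countable K] [MeasurableSpace K]
    [DiscreteMeasurableSpace K] {w : K → Plane → ℝ} (hw : ∀ a, Measurable (w a)) {k : Plane → K}
    (hk : Measurable k) : Measurable (Function.uncurry fun x => w (k x)) := by
  have : Measurable fun q : K × Plane => w q.1 q.2 := measurable_from_prod_countable_right hw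
  exact this.comp ((hk.comp measurable_fst).prodMk measurable_snd)

lemma palmProd_eq_prod {Ω : Type*} {X : ℕ → Ω → Plane} {G : Plane → Plane → ℝ} {B : Set Plane} {ω : Ω}
    (hω : {i | X i ω ∈ B}.Finite) (hG : ∀ x y, G x y ∈ Set.Icc (0 : ℝ) 1)
    (hG' : ∀ x, ∀ y ∉ B, G x y = 1) :
    palmProd X G ω = ∏ j ∈ hω.toFinset, if j = tagged X ω then 1 else
      ENNReal.ofReal (G (X (tagged X ω) ω) (X j ω)) := by
  refine seqProd_eq_prod (fun j => ?_) _ fun j hj => ?_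
  · split_ifs
    exacts [le_rfl, by simpa using (hG _ _).2]
  · have : X j ω ∉ B := fun hj' => hj (hω.mem_toFinset.2 hj')
    rw [hG' _ _ this]; simp

-- The grid kernels take countably many values and, by rounding up, vanish within the norm of every
-- point of their cell, so the countable formula holds for each of them. Both sides then pass to the
-- limit by dominated convergence, finitely many points lying in the window.
open Classical in
lemma IsHomogeneousPPP.lintegral_palmProd_window [IsProbabilityMeasure P]
    (h : IsHomogeneousPPP P lam X) (hlam : 0 ≤ lam) (R : ℝ) {v : Plane → Plane → ℝ}
    (hvm : Measurable (Function.uncurry v)) (hv : ∀ x y, v x y ∈ Set.Icc (0 : ℝ) 1)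
    (hcont : ∀ y, Continuous fun x => v x y) :
    ∫⁻ ω, (if X (tagged X ω) ω ∈ Metric.closedBall 0 R then
        palmProd X (fun x => screened R ‖x‖ (v x)) ω else 0) ∂P =
      ∫⁻ x in Metric.closedBall 0 R,
        ENNReal.ofReal (lam * Real.exp (-(lam * ∫ y, (1 - screened R ‖x‖ (v x) y)))) := by
  let w : ℕ → ℕ × ℕ → Plane → ℝ := fun n a => screened R (gridNorm n a) (v (gridPoint a))
  have hvm' : ∀ x, Measurable (v x) := fun x => hvm.of_uncurry_left
  have hwm : ∀ n a, Measurable (w n a) := fun n a =>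
    measurable_screened measurable_const measurable_id (hvm' _)
  have hB : MeasurableSet (Metric.closedBall (0 : Plane) R) :=
    Metric.isClosed_closedBall.measurableSet
  have hB' : volume (Metric.closedBall (0 : Plane) R) ≠ ⊤ := measure_closedBall_lt_top.ne
  have hGm : ∀ n, Measurable (Function.uncurry fun x => w n (gridIndex n x)) := fun n =>
    measurable_uncurry_of_countable (hwm n) (measurable_gridIndex n)
  have hstep := fun n => h.lintegral_palmProd_of_countable hlam (measurable_gridIndex n)
    (hwm n) (fun a => screened_mem _ _ (hv _)) hB hB' (fun a y hy => screened_eq_one hy)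
    (fun x hx y hy => by
      rw [mem_closedBall_zero_iff] at hx
      simp only [w]
      rw [screened, if_pos (hy.trans hx), if_pos (hy.trans (norm_le_gridNorm n x))])
  have hlim : ∀ x y, Tendsto (fun n => w n (gridIndex n x) y) atTop
      (𝓝 (screened R ‖x‖ (v x) y)) := tendsto_screened hcont
  refine tendsto_nhds_unique (f := fun n => ∫⁻ ω, (if X (tagged X ω) ω ∈ Metric.closedBall 0 R then
        palmProd X (fun x => w n (gridIndex n x)) ω else 0) ∂P) (l := atTop) ?_ ?_
  · refine tendsto_lintegral_of_dominated_convergence (fun _ => 1)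
      (fun n => Measurable.ite (measurable_tagged_point h.measurable hB)
        (measurable_palmProd h.measurable (hGm n)) measurable_const)
      (fun n => .of_forall fun ω => ?_) (by simp) ?_
    · dsimp only
      split_ifs
      exacts [seqProd_le_one _, zero_le_one]
    · filter_upwards [h.ae_finite] with ω hω
      split_ifs
      · simp_rw [palmProd_eq_prod (G := fun x => w _ (gridIndex _ x)) (hω R)
            (fun x => screened_mem _ _ (hv _)) (fun x y hy => screened_eq_one hy),
          palmProd_eq_prod (G := fun x => screened R ‖x‖ (v x)) (hω R)
            (fun x => screened_mem _ _ (hv _)) (fun x y hy => screened_eq_one hy)]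
        refine ENNReal.tendsto_finsetProd_of_ne_top _ (fun j _ => ?_) fun j _ => ?_
        · split_ifs
          · exact tendsto_const_nhds
          · exact ENNReal.tendsto_ofReal (hlim _ _)
        · split_ifs
          exacts [ENNReal.one_ne_top, ENNReal.ofReal_ne_top]
      · exact tendsto_const_nhds
  · simp_rw [hstep]
    refine tendsto_lintegral_of_dominated_convergence (fun _ => ENNReal.ofReal lam)
      (fun n => measurable_palm_density (hGm n)) (fun n => .of_forall fun x => ?_) ?_
      (.of_forall fun x => ?_)
    · refine ENNReal.ofReal_le_ofReal (mul_le_of_le_one_right hlam (Real.exp_le_one_iff.2 ?_))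
      refine neg_nonpos.2 (mul_nonneg hlam (integral_nonneg fun y => ?_))
      exact sub_nonneg.2 (screened_mem _ _ (hv _) y).2
    · rw [lintegral_const, Measure.restrict_apply_univ]
      exact ENNReal.mul_ne_top ENNReal.ofReal_ne_top hB'
    · refine ENNReal.tendsto_ofReal (Tendsto.const_mul _ ((Real.continuous_exp.tendsto _).comp
        (Tendsto.neg (Tendsto.const_mul _ ?_))))
      refine tendsto_integral_of_dominated_convergence
        ((Metric.closedBall (0 : Plane) R).indicator fun _ => 1)
        (fun n => (measurable_const.sub (hwm n _)).aestronglyMeasurable)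
        ((integrable_indicator_iff hB).2 (integrableOn_const hB'))
        (fun n => .of_forall fun y => ?_) (.of_forall fun y => (hlim x y).const_sub 1)
      by_cases hy : y ∈ Metric.closedBall 0 R
      · rw [Set.indicator_of_mem hy, Real.norm_eq_abs, abs_le]
        have := screened_mem R (gridNorm n (gridIndex n x)) (hv (gridPoint (gridIndex n x))) y
        constructor <;> simp only [w] <;> linarith [this.1, this.2]
      · rw [Set.indicator_of_notMem hy]
        simp only [w, screened_eq_one hy]
        simp

lemma volume_real_closedBall {r : ℝ} (hr : 0 ≤ r) :
    volume.real (Metric.closedBall (0 : Plane) r) = Real.pi * r ^ 2 := by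
  rw [measureReal_def, EuclideanSpace.volume_closedBall_fin_two, ENNReal.toReal_mul,
    ENNReal.toReal_pow, ENNReal.toReal_ofReal hr]
  simp [mul_comm, Real.pi_nonneg]

lemma integral_gaussian_plane (hlam : 0 < lam) :
    ∫ x : Plane, lam * Real.exp (-(lam * (Real.pi * ‖x‖ ^ 2))) = 1 := by
  have := GaussianFourier.integral_rexp_neg_mul_sq_norm (V := Plane) (b := lam * Real.pi)
    (by positivity)
  rw [integral_const_mul]
  have e : ∀ x : Plane, -(lam * (Real.pi * ‖x‖ ^ 2)) = -(lam * Real.pi) * ‖x‖ ^ 2 := fun x => by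
    ring
  simp_rw [e, this]
  simp
  field_simp

lemma integrable_gaussian_plane (hlam : 0 < lam) :
    Integrable fun x : Plane => lam * Real.exp (-(lam * (Real.pi * ‖x‖ ^ 2))) :=
  .of_integral_ne_zero (by rw [integral_gaussian_plane hlam]; exact one_ne_zero)

lemma lintegral_gaussian_plane (hlam : 0 < lam) :
    ∫⁻ x : Plane, ENNReal.ofReal (lam * Real.exp (-(lam * (Real.pi * ‖x‖ ^ 2)))) = 1 := by
  rw [← ofReal_integral_eq_lintegral_ofReal (integrable_gaussian_plane hlam)
    (.of_forall fun x => by positivity), integral_gaussian_plane hlam, ENNReal.ofReal_one]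

lemma pi_mul_sq_le_integral {w : Plane → ℝ} (hint : Integrable fun y => 1 - w y)
    (hw : ∀ y, w y ≤ 1) {r : ℝ} (hr : 0 ≤ r) (h0 : ∀ y, ‖y‖ ≤ r → w y = 0) :
    Real.pi * r ^ 2 ≤ ∫ y, (1 - w y) := by
  rw [← volume_real_closedBall hr,
    ← integral_indicator_one (Metric.isClosed_closedBall.measurableSet)]
  refine integral_mono_of_nonneg (.of_forall fun y => Set.indicator_nonneg (by simp) y) hint
    (.of_forall fun y => ?_)
  by_cases hy : y ∈ Metric.closedBall (0 : Plane) r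
  · simp [Set.indicator_of_mem hy, h0 y (by simpa using hy)]
  · simp [Set.indicator_of_notMem hy, hw y]

/-! ### Removing the window, and uniqueness of the closest point. -/

/-- `v`, set to `0` in the closed ball of radius `ρ` around the origin. -/
def shielded (ρ : ℝ) (v : Plane → ℝ) (y : Plane) : ℝ := if ‖y‖ ≤ ρ then 0 else v y

lemma shielded_mem (ρ : ℝ) {v : Plane → ℝ} (hv : ∀ y, v y ∈ Set.Icc (0 : ℝ) 1) (y : Plane) :
    shielded ρ v y ∈ Set.Icc (0 : ℝ) 1 := by
  unfold shielded; split_ifs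
  exacts [by simp, hv y]

lemma screened_eq_shielded {R ρ : ℝ} {v : Plane → ℝ} {y : Plane} (hy : ‖y‖ ≤ R) :
    screened R ρ v y = shielded ρ v y := if_pos hy

lemma integrable_one_sub_shielded {ρ : ℝ} {v : Plane → ℝ} (hint : Integrable fun y => 1 - v y) :
    Integrable fun y => 1 - shielded ρ v y := by
  classical
  have hB : MeasurableSet (Metric.closedBall (0 : Plane) ρ) :=
    Metric.isClosed_closedBall.measurableSet
  have e : (fun y => 1 - shielded ρ v y) =
      (Metric.closedBall (0 : Plane) ρ).piecewise (fun _ => 1) fun y => 1 - v y := by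
    ext y
    by_cases hy : y ∈ Metric.closedBall (0 : Plane) ρ
    · rw [Set.piecewise_eq_of_mem _ _ _ hy, shielded, if_pos (by simpa using hy), sub_zero]
    · rw [Set.piecewise_eq_of_notMem _ _ _ hy, shielded, if_neg (by simpa using hy)]
  rw [e]
  exact Integrable.piecewise hB (integrableOn_const measure_closedBall_lt_top.ne)
    hint.integrableOn

lemma IsHomogeneousPPP.lintegral_palmProd_shielded [IsProbabilityMeasure P]
    (h : IsHomogeneousPPP P lam X) (hlam : 0 < lam) {v : Plane → Plane → ℝ}
    (hvm : Measurable (Function.uncurry v)) (hv : ∀ x y, v x y ∈ Set.Icc (0 : ℝ) 1)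
    (hcont : ∀ y, Continuous fun x => v x y) (hint : ∀ x, Integrable fun y => 1 - v x y) :
    ∫⁻ ω, palmProd X (fun x => shielded ‖x‖ (v x)) ω ∂P =
      ∫⁻ x, ENNReal.ofReal (lam * Real.exp (-(lam * ∫ y, (1 - shielded ‖x‖ (v x) y)))) := by
  classical
  have hB : ∀ n : ℕ, MeasurableSet (Metric.closedBall (0 : Plane) n) := fun n =>
    Metric.isClosed_closedBall.measurableSet
  have hvm' : ∀ x, Measurable (v x) := fun x => hvm.of_uncurry_left
  have hGm : ∀ R, Measurable (Function.uncurry fun x => screened R ‖x‖ (v x)) := fun R =>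
    measurable_screened (v := fun q : Plane × Plane => v q.1) measurable_fst.norm
      measurable_snd hvm
  have hev : ∀ x : Plane, ∀ᶠ n : ℕ in atTop, ‖x‖ ≤ n := fun x => by
    filter_upwards [eventually_ge_atTop ⌈‖x‖⌉₊] with n hn
    exact Nat.ceil_le.1 hn
  have hstep := fun n : ℕ => h.lintegral_palmProd_window hlam.le n hvm hv hcont
  refine tendsto_nhds_unique (f := fun n : ℕ => ∫⁻ ω, (if X (tagged X ω) ω ∈
    Metric.closedBall 0 (n : ℝ) then palmProd X (fun x => screened n ‖x‖ (v x)) ω else 0) ∂P)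
    (l := atTop) ?_ ?_
  · refine tendsto_lintegral_of_dominated_convergence (fun _ => 1)
      (fun n => Measurable.ite (measurable_tagged_point h.measurable (hB n))
        (measurable_palmProd h.measurable (hGm n)) measurable_const)
      (fun n => .of_forall fun ω => ?_) (by simp) (.of_forall fun ω => ?_)
    · dsimp only
      split_ifs
      exacts [seqProd_le_one _, zero_le_one]
    · have : Tendsto (fun n : ℕ => palmProd X (fun x => screened n ‖x‖ (v x)) ω) atTop
          (𝓝 (palmProd X (fun x => shielded ‖x‖ (v x)) ω)) := by
        refine tendsto_seqProd_of_antitone (fun j a b hab => ?_) fun j => ?_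
        · dsimp only
          split_ifs
          · exact le_rfl
          · refine ENNReal.ofReal_le_ofReal ?_
            by_cases ha : ‖X j ω‖ ≤ a
            · rw [screened_eq_shielded ha, screened_eq_shielded (ha.trans (Nat.cast_le.2 hab))]
            · rw [screened_eq_one (y := X j ω) (R := a) (by simpa using ha)]
              exact (screened_mem _ _ (hv _) _).2
        · filter_upwards [hev (X j ω)] with n hn
          rw [screened_eq_shielded hn]
      refine this.congr' ?_
      filter_upwards [hev (X (tagged X ω) ω)] with n hn
      rw [if_pos (by simpa using hn)]
  · simp_rw [hstep, ← lintegral_indicator (hB _)]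
    -- Every kernel in the window vanishes on the ball of radius `‖x‖`, which makes the exponent at
    -- least λπ‖x‖². Hence the Gaussian bound, uniform in the window.
    refine tendsto_lintegral_of_dominated_convergence
      (fun x => ENNReal.ofReal (lam * Real.exp (-(lam * (Real.pi * ‖x‖ ^ 2)))))
      (fun n => (measurable_palm_density (hGm n)).indicator (hB n))
      (fun n => .of_forall fun x => ?_)
      (by rw [lintegral_gaussian_plane hlam]; exact ENNReal.one_ne_top) (.of_forall fun x => ?_)
    · by_cases hx : x ∈ Metric.closedBall (0 : Plane) n
      · rw [Set.indicator_of_mem hx]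
        rw [mem_closedBall_zero_iff] at hx
        refine ENNReal.ofReal_le_ofReal (mul_le_mul_of_nonneg_left (Real.exp_le_exp.2
          (neg_le_neg (mul_le_mul_of_nonneg_left ?_ hlam.le))) hlam.le)
        refine pi_mul_sq_le_integral (integrable_one_sub_screened (hvm' x) (hv x))
          (fun y => (screened_mem _ _ (hv x) y).2) (norm_nonneg x) fun y hy => ?_
        rw [screened, if_pos (hy.trans hx), if_pos hy]
      · rw [Set.indicator_of_notMem hx]
        exact zero_le
    · have hlim : Tendsto (fun n : ℕ => ∫ y, (1 - screened n ‖x‖ (v x) y)) atTop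
          (𝓝 (∫ y, (1 - shielded ‖x‖ (v x) y))) := by
        refine tendsto_integral_of_dominated_convergence (fun y => 1 - shielded ‖x‖ (v x) y)
          (fun n => (integrable_one_sub_screened (hvm' x) (hv x)).aestronglyMeasurable)
          (integrable_one_sub_shielded (hint x)) (fun n => .of_forall fun y => ?_)
          (.of_forall fun y => ?_)
        · have h0 := shielded_mem ‖x‖ (hv x) y
          by_cases hy : ‖y‖ ≤ n
          · rw [screened_eq_shielded hy, Real.norm_of_nonneg (by linarith [h0.2])]
          · rw [screened_eq_one (by simpa using hy)]
            simpa using h0.2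
        · refine tendsto_const_nhds.congr' ((hev y).mono fun n hn => ?_)
          simp only [screened_eq_shielded hn]
      refine (ENNReal.tendsto_ofReal (Tendsto.const_mul lam ((Real.continuous_exp.tendsto _).comp
        (Tendsto.neg (Tendsto.const_mul lam hlim))))).congr' ?_
      filter_upwards [hev x] with n hn
      rw [Set.indicator_of_mem (by simpa using hn)]
      rfl

lemma integral_one_sub_shielded {ρ : ℝ} (hρ : 0 ≤ ρ) {v : Plane → ℝ}
    (hint : Integrable fun y => 1 - v y) :
    ∫ y, (1 - shielded ρ v y) =
      Real.pi * ρ ^ 2 + ∫ y in (Metric.closedBall (0 : Plane) ρ)ᶜ, (1 - v y) := by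
  have hB : MeasurableSet (Metric.closedBall (0 : Plane) ρ) :=
    Metric.isClosed_closedBall.measurableSet
  rw [← integral_add_compl hB (integrable_one_sub_shielded hint), ← volume_real_closedBall hρ]
  congr 1
  · rw [setIntegral_congr_fun (g := fun _ => (1 : ℝ)) hB]
    · simp
    · intro y hy
      simp only [shielded]
      rw [if_pos (by simpa using hy), sub_zero]
  · refine setIntegral_congr_fun hB.compl fun y hy => ?_
    simp only [shielded]
    rw [if_neg (by simpa using hy)]

/-- Almost surely, the point closest to the origin is unique. -/
lemma IsHomogeneousPPP.ae_norm_tagged_lt [IsProbabilityMeasure P]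
    (h : IsHomogeneousPPP P lam X) (hlam : 0 < lam) :
    ∀ᵐ ω ∂P, ∀ j, j ≠ tagged X ω → ‖X (tagged X ω) ω‖ < ‖X j ω‖ := by
  have h1 : ∀ x y : Plane, (fun _ _ => 1 : Plane → Plane → ℝ) x y ∈ Set.Icc (0 : ℝ) 1 := by simp
  -- With `v = 1` the shielded product is the indicator that no other point is as close as the
  -- tagged one. Its expectation is the Gaussian mass 1, so it equals 1 almost surely.
  have hmass := h.lintegral_palmProd_shielded hlam (v := fun _ _ => 1) measurable_const h1
    (fun _ => continuous_const) (by simp)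
  have hG : ∀ x : Plane, ∫ y, (1 - shielded ‖x‖ (fun _ => 1) y) = Real.pi * ‖x‖ ^ 2 := fun x => by
    rw [integral_one_sub_shielded (norm_nonneg x) (by simp)]; simp
  simp_rw [hG] at hmass
  rw [lintegral_gaussian_plane hlam] at hmass
  have hae := ae_eq_of_ae_le_of_lintegral_le (μ := P) (g := fun _ => (1 : ℝ≥0∞))
    (f := palmProd X fun x => shielded ‖x‖ fun _ => 1)
    (.of_forall fun ω => seqProd_le_one _) (by rw [hmass]; exact ENNReal.one_ne_top)
    aemeasurable_const (by rw [hmass]; simp)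
  filter_upwards [hae] with ω hω j hj
  by_contra hle
  have h0 : palmProd X (fun x => shielded ‖x‖ (fun _ => 1)) ω = 0 := by
    refine seqProd_eq_zero j ?_
    simp only [shielded]
    rw [if_neg hj, if_pos (not_lt.1 hle), ENNReal.ofReal_zero]
  rw [h0] at hω
  exact zero_ne_one hω

/-- Expectation of a multiplicative functional of a Poisson point process seen from the point
closest to the origin. -/
theorem IsHomogeneousPPP.lintegral_palmProd [IsProbabilityMeasure P]
    (h : IsHomogeneousPPP P lam X) (hlam : 0 < lam) {v : Plane → Plane → ℝ}
    (hvm : Measurable (Function.uncurry v)) (hv : ∀ x y, v x y ∈ Set.Icc (0 : ℝ) 1)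
    (hcont : ∀ y, Continuous fun x => v x y) (hint : ∀ x, Integrable fun y => 1 - v x y) :
    ∫⁻ ω, palmProd X v ω ∂P =
      ∫⁻ x, ENNReal.ofReal (lam * Real.exp (-(lam * (Real.pi * ‖x‖ ^ 2)))) *
        ENNReal.ofReal (Real.exp (-(lam *
          ∫ y in (Metric.closedBall (0 : Plane) ‖x‖)ᶜ, (1 - v x y)))) := by
  have hae : ∀ᵐ ω ∂P, palmProd X v ω = palmProd X (fun x => shielded ‖x‖ (v x)) ω := by
    filter_upwards [h.ae_norm_tagged_lt hlam] with ω hω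
    refine congrArg seqProd (funext fun j => ?_)
    split_ifs with hj
    · rfl
    · simp only [shielded]
      rw [if_neg (not_le.2 (hω j hj))]
  rw [lintegral_congr_ae hae, h.lintegral_palmProd_shielded hlam hvm hv hcont hint]
  refine lintegral_congr fun x => ?_
  rw [← ENNReal.ofReal_mul (by positivity), integral_one_sub_shielded (norm_nonneg x) (hint x),
    mul_add, neg_add, Real.exp_add, mul_assoc]

end Functional

/-! ### Independence of the marks and the conditional access probability. -/

section Marks

variable {Ω : Type*} [MeasurableSpace Ω] {P : Measure Ω}

/-- Grouping independent random variables by the first index. -/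
lemma iIndepFun_curry [IsProbabilityMeasure P] {ι κ E : Type*} [MeasurableSpace E]
    {U : ι × κ → Ω → E} (hm : ∀ p, Measurable (U p)) (hi : iIndepFun U P) :
    iIndepFun (fun i ω q => U (i, q) ω) P := by
  have : ∀ p, IsProbabilityMeasure (P.map (U p)) :=
    fun p => Measure.isProbabilityMeasure_map (hm p).aemeasurable
  have hrow : ∀ i, P.map (fun ω q => U (i, q) ω) = Measure.infinitePi fun q => P.map (U (i, q)) :=
    fun i => (hi.precomp (Prod.mk_right_injective i)).map_fun_eq_infinitePi_map fun q => hm (i, q)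
  rw [iIndepFun_iff_map_fun_eq_infinitePi_map (fun i => measurable_pi_lambda _ fun q => hm (i, q))]
  simp_rw [hrow]
  rw [← Measure.infinitePi_map_curry (fun i q => P.map (U (i, q))),
    ← hi.map_fun_eq_infinitePi_map hm, Measure.map_map (by fun_prop) (measurable_pi_lambda _ hm)]
  rfl

/-- Fubini: `V none` is independent of the block formed by the first `n` other variables, and for a
fixed value `t` of `V none` the conditions on that block are independent of one another. -/
lemma measure_forall_mem_eq_lintegral [IsProbabilityMeasure P] {E : Type*} [MeasurableSpace E]
    {V : Option ℕ → Ω → E} (hm : ∀ o, Measurable (V o)) (hi : iIndepFun V P)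
    {S : ℕ → Set (E × E)} (hS : ∀ j, MeasurableSet (S j)) (n : ℕ) :
    P {ω | ∀ j < n, (V none ω, V (some j) ω) ∈ S j} =
      ∫⁻ t, ∏ j ∈ Finset.range n, P {ω | (t, V (some j) ω) ∈ S j} ∂(P.map (V none)) := by
  classical
  let s : Finset (Option ℕ) := (Finset.range n).image some
  have hdisj : Disjoint {none} s := by simp [s]
  have hind := hi.indepFun_finset {none} s hdisj hm
  have heval : Measurable fun f : ({none} : Finset (Option ℕ)) → E => f ⟨none, by simp⟩ :=
    measurable_pi_apply _
  have hind' : IndepFun (V none) (fun ω (o : s) => V o ω) P := hind.comp heval measurable_id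
  have hW : Measurable fun ω (o : s) => V o ω := measurable_pi_lambda _ fun o => hm o
  let A : Set (E × (s → E)) := {q | ∀ j, ∀ hj : j < n, (q.1, q.2 ⟨some j, by simp [s, hj]⟩) ∈ S j}
  have hA : MeasurableSet A := by
    have : A = ⋂ j, ⋂ hj : j < n,
        (fun q : E × (s → E) => (q.1, q.2 ⟨some j, by simp [s, hj]⟩)) ⁻¹' S j := by
      ext q; simp [A]
    rw [this]
    exact .iInter fun j => .iInter fun hj => (hS j).preimage (by fun_prop)
  have h1 : {ω | ∀ j < n, (V none ω, V (some j) ω) ∈ S j} =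
      (fun ω => (V none ω, fun o : s => V o ω)) ⁻¹' A := rfl
  rw [h1, ← Measure.map_apply ((hm none).prodMk hW) hA,
    (indepFun_iff_map_prod_eq_prod_map_map (hm none).aemeasurable hW.aemeasurable).1 hind',
    Measure.prod_apply hA]
  refine lintegral_congr fun t => ?_
  rw [Measure.map_apply hW (measurable_prodMk_left hA)]
  have h2 : (fun ω (o : s) => V o ω) ⁻¹' (Prod.mk t ⁻¹' A) =
      ⋂ j ∈ Finset.range n, V (some j) ⁻¹' (Prod.mk t ⁻¹' S j) := by
    ext ω; simp [A]
  rw [h2]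
  exact (hi.precomp (Option.some_injective ℕ)).measure_inter_preimage_eq_mul _
    fun j _ => measurable_prodMk_left (hS j)

lemma measure_forall_mem_eq_lintegral_seqProd [IsProbabilityMeasure P] {E : Type*}
    [MeasurableSpace E] {V : Option ℕ → Ω → E} (hm : ∀ o, Measurable (V o)) (hi : iIndepFun V P)
    {S : ℕ → Set (E × E)} (hS : ∀ j, MeasurableSet (S j)) :
    P {ω | ∀ j, (V none ω, V (some j) ω) ∈ S j} =
      ∫⁻ t, seqProd (fun j => P {ω | (t, V (some j) ω) ∈ S j}) ∂(P.map (V none)) := by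
  have := Measure.isProbabilityMeasure_map (μ := P) (hm none).aemeasurable
  have hset : ∀ j, MeasurableSet {ω | (V none ω, V (some j) ω) ∈ S j} := fun j =>
    ((hm none).prodMk (hm (some j))) (hS j)
  have hfac : ∀ j, Measurable fun t => P {ω | (t, V (some j) ω) ∈ S j} := fun j => by
    have hpre : MeasurableSet ((fun q : E × Ω => (q.1, V (some j) q.2)) ⁻¹' S j) :=
      (hS j).preimage (measurable_fst.prodMk ((hm _).comp measurable_snd))
    exact measurable_measure_prodMk_left hpre
  have hinter : {ω | ∀ j, (V none ω, V (some j) ω) ∈ S j} =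
      ⋂ n : ℕ, {ω | ∀ j < n, (V none ω, V (some j) ω) ∈ S j} := by
    ext ω
    simp only [Set.mem_iInter]
    exact ⟨fun h n j _ => h j, fun h j => h (j + 1) j j.lt_succ_self⟩
  refine tendsto_nhds_unique (f := fun n : ℕ =>
    P {ω | ∀ j < n, (V none ω, V (some j) ω) ∈ S j}) (l := atTop) ?_ ?_
  · rw [hinter]
    refine tendsto_measure_iInter_atTop (fun n => ?_) (fun a b hab ω hω j hj =>
      hω j (hj.trans_le hab)) ⟨0, measure_ne_top _ _⟩
    have : {ω | ∀ j < n, (V none ω, V (some j) ω) ∈ S j} =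
        ⋂ j, ⋂ _ : j < n, {ω | (V none ω, V (some j) ω) ∈ S j} := by
      ext ω; simp
    rw [this]
    exact (MeasurableSet.iInter fun j => .iInter fun _ => hset j).nullMeasurableSet
  · simp_rw [measure_forall_mem_eq_lintegral hm hi hS]
    refine tendsto_lintegral_of_dominated_convergence (fun _ => 1)
      (fun n => Finset.measurable_prod _ fun j _ => hfac j)
      (fun n => .of_forall fun t => Finset.prod_le_one' fun j _ => prob_le_one) (by simp)
      (.of_forall fun t => tendsto_seqProd fun j => prob_le_one)

lemma measure_or_and [IsProbabilityMeasure P] {T G H : Ω → ℝ} (hT : Measurable T)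
    (hG : Measurable G) (hTG : IndepFun T G P)
    (hTGH : IndepFun (fun ω => (T ω, G ω)) H P) (t : ℝ) {K U : Set ℝ} (hK : MeasurableSet K)
    (hU : MeasurableSet U) :
    P {ω | (t ≤ T ω ∨ G ω ∈ K) ∧ H ω ∈ U} =
      (1 - P {ω | T ω < t} * P {ω | G ω ∉ K}) * P {ω | H ω ∈ U} := by
  have hA : MeasurableSet {q : ℝ × ℝ | t ≤ q.1 ∨ q.2 ∈ K} :=
    (measurableSet_le measurable_const measurable_fst).union (measurable_snd hK)
  have h1 : P {ω | (t ≤ T ω ∨ G ω ∈ K) ∧ H ω ∈ U} = P {ω | t ≤ T ω ∨ G ω ∈ K} * P {ω | H ω ∈ U} :=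
    hTGH.measure_inter_preimage_eq_mul _ _ hA hU
  have h2 : P {ω | T ω < t ∧ G ω ∉ K} = P {ω | T ω < t} * P {ω | G ω ∉ K} :=
    hTG.measure_inter_preimage_eq_mul _ _ measurableSet_Iio hK.compl
  have h3 : {ω | t ≤ T ω ∨ G ω ∈ K} = {ω | T ω < t ∧ G ω ∉ K}ᶜ := by
    ext ω
    simp only [Set.mem_compl_iff, Set.mem_ofPred_eq, not_and_or, not_lt, not_not]
  have hTK : MeasurableSet {ω | T ω < t ∧ G ω ∉ K} :=
    (hT measurableSet_Iio).inter (hG hK.compl)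
  rw [h1, h3, prob_compl_eq_one_sub hTK, h2]

/-- Probability that all transmitters, given by groups of three independent marks, let a node with
an independent timer access the medium. -/
lemma measure_forall_access [IsProbabilityMeasure P] {ι : Type*} {Z : ι → Ω → ℝ}
    (hm : ∀ m, Measurable (Z m)) (hi : iIndepFun Z P) {e : Option ℕ × Fin 3 → ι}
    (he : Function.Injective e) (i : ℕ) {K U : ℕ → Set ℝ} (hK : ∀ j, MeasurableSet (K j))
    (hU : ∀ j, MeasurableSet (U j)) :
    P {ω | ∀ j, (j = i ∨ Z (e (none, 0)) ω ≤ Z (e (some j, 0)) ω ∨ Z (e (some j, 1)) ω ∈ K j) ∧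
        Z (e (some j, 2)) ω ∈ U j} =
      ∫⁻ t, seqProd (fun j => (if j = i then 1 else
        1 - P {ω | Z (e (some j, 0)) ω < t} * P {ω | Z (e (some j, 1)) ω ∉ K j}) *
          P {ω | Z (e (some j, 2)) ω ∈ U j}) ∂(P.map (Z (e (none, 0)))) := by
  have hi' := hi.precomp he
  have hV := iIndepFun_curry (U := fun p => Z (e p)) (fun p => hm _) hi'
  have hVm : ∀ o : Option ℕ, Measurable fun ω (q : Fin 3) => Z (e (o, q)) ω :=
    fun o => measurable_pi_lambda _ fun q => hm _
  let S : ℕ → Set ((Fin 3 → ℝ) × (Fin 3 → ℝ)) := fun j =>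
    {q | (j = i ∨ q.1 0 ≤ q.2 0 ∨ q.2 1 ∈ K j) ∧ q.2 2 ∈ U j}
  have hS : ∀ j, MeasurableSet (S j) := fun j => by
    refine MeasurableSet.inter (MeasurableSet.union (MeasurableSet.const _)
      (MeasurableSet.union (measurableSet_le
        (f := fun q : (Fin 3 → ℝ) × (Fin 3 → ℝ) => q.1 0) (g := fun q => q.2 0)
        (by fun_prop) (by fun_prop)) ?_)) ?_
    · exact (hK j).preimage (f := fun q : (Fin 3 → ℝ) × (Fin 3 → ℝ) => q.2 1) (by fun_prop)
    · exact (hU j).preimage (f := fun q : (Fin 3 → ℝ) × (Fin 3 → ℝ) => q.2 2) (by fun_prop)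
  refine (measure_forall_mem_eq_lintegral_seqProd hVm hV hS).trans ?_
  have hfac : ∀ t : Fin 3 → ℝ, ∀ j, P {ω | (t, fun q : Fin 3 => Z (e (some j, q)) ω) ∈ S j} =
      (if j = i then 1 else
        1 - P {ω | Z (e (some j, 0)) ω < t 0} * P {ω | Z (e (some j, 1)) ω ∉ K j}) *
          P {ω | Z (e (some j, 2)) ω ∈ U j} := fun t j => by
    by_cases hj : j = i
    · simp only [S, Set.mem_ofPred_eq, hj, true_or, true_and, if_true, one_mul]
    · simp only [S, Set.mem_ofPred_eq, hj, false_or, if_false]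
      refine measure_or_and (hm _) (hm _) (hi'.indepFun (by simp))
        (hi'.indepFun_prodMk (fun _ => hm _) _ _ _ (by simp) (by simp)) (t 0) (hK j) (hU j)
  simp_rw [hfac]
  -- The integrand depends only on coordinate 0 of the node's own group; the other two coordinates
  -- are padding.
  have hmap : P.map (Z (e (none, 0))) = (P.map fun ω (q : Fin 3) => Z (e (none, q)) ω).map
      fun f => f 0 := by
    rw [Measure.map_map (by fun_prop) (hVm none)]; rfl
  have hF : Measurable fun t : ℝ => seqProd (fun j => (if j = i then 1 else
      1 - P {ω | Z (e (some j, 0)) ω < t} * P {ω | Z (e (some j, 1)) ω ∉ K j}) *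
        P {ω | Z (e (some j, 2)) ω ∈ U j}) := by
    refine measurable_seqProd fun j => Measurable.mul_const ?_ _
    split_ifs
    · exact measurable_const
    · refine measurable_const.sub (Measurable.mul_const ?_ _)
      exact Monotone.measurable fun a b hab => measure_mono fun ω (hω : _ < a) => hω.trans_le hab
  rw [hmap, lintegral_map hF (measurable_pi_apply 0)]

end Marks

/-! ### Detection probabilities and the laws of timers and fadings. -/

/-- Probability that the fading of a transmitter at distance `d` exceeds `θ` times the path loss
(with the path loss `0` at distance `0`, division by which gives `0`). -/
def Params.detect (p : Params) (θ d : ℝ) : ℝ :=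
  if d = 0 then 0 else Real.exp (-p.μ * θ * p.pathLoss d)

lemma Params.pathLoss_pos (p : Params) {d : ℝ} (hd : 0 < d) : 0 < p.pathLoss d := by
  have := p.lamc_pos
  unfold Params.pathLoss
  positivity

lemma Params.pathLoss_nonneg (p : Params) {d : ℝ} (hd : 0 ≤ d) : 0 ≤ p.pathLoss d := by
  unfold Params.pathLoss
  positivity

lemma Params.pathLoss_zero (p : Params) : p.pathLoss 0 = 0 := by
  rw [Params.pathLoss, Real.zero_rpow p.α_pos.ne', mul_zero]

lemma Params.exp_mem (p : Params) {θ d : ℝ} (hθ : 0 ≤ θ) (hd : 0 ≤ d) :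
    Real.exp (-p.μ * θ * p.pathLoss d) ∈ Set.Icc (0 : ℝ) 1 := by
  refine ⟨(Real.exp_pos _).le, Real.exp_le_one_iff.2 ?_⟩
  have := mul_nonneg (mul_nonneg p.μ_pos.le hθ) (p.pathLoss_nonneg hd)
  linarith

lemma Params.detect_mem (p : Params) {θ d : ℝ} (hθ : 0 ≤ θ) (hd : 0 ≤ d) :
    p.detect θ d ∈ Set.Icc (0 : ℝ) 1 := by
  unfold Params.detect; split_ifs
  exacts [by simp, p.exp_mem hθ hd]

section Laws

variable {Ω : Type*} [MeasurableSpace Ω] {P : Measure Ω}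

lemma measure_fading [IsProbabilityMeasure P] (p : Params) {G : Ω → ℝ}
    (hG : HasLaw G (expMeasure p.μ) P) {θ d : ℝ} (hθ : 0 ≤ θ) (hd : 0 ≤ d) :
    P {ω | G ω ∉ {g | g / p.pathLoss d ≤ θ}} = ENNReal.ofReal (p.detect θ d) := by
  rcases hd.eq_or_lt with rfl | hd
  · simp [Params.detect, p.pathLoss_zero, hθ]
  · have hl := p.pathLoss_pos hd
    have := isProbabilityMeasure_expMeasure p.μ_pos
    have hset : {x : ℝ | x ∉ {g | g / p.pathLoss d ≤ θ}} = (Set.Iic (θ * p.pathLoss d))ᶜ := by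
      ext x; simp [div_le_iff₀ hl]
    rw [hG.measure_eq (p := fun x => x ∉ {g | g / p.pathLoss d ≤ θ})
      (by rw [hset]; exact measurableSet_Iic.compl), hset, prob_compl_eq_one_sub measurableSet_Iic,
      ← ofReal_cdf, cdf_expMeasure_eq p.μ_pos, if_pos (by positivity), Params.detect,
      if_neg hd.ne', ← ENNReal.ofReal_one, ← ENNReal.ofReal_sub]
    · congr 1
      rw [sub_sub_cancel]; congr 1; ring
    · rw [sub_nonneg, Real.exp_le_one_iff, neg_nonpos]
      have := p.μ_pos
      positivity

lemma cond_volume_Icc {a b : ℝ} (hab : b = a + 1) :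
    cond volume (Set.Icc a b) = volume.restrict (Set.Icc a b) := by
  simp [ProbabilityTheory.cond, hab]

lemma measure_timer_lt {T : Ω → ℝ} {a b : ℝ} (hab : b = a + 1)
    (hT : HasLaw T (cond volume (Set.Icc a b)) P) {t : ℝ} (ht : t ∈ Set.Icc a b) :
    P {ω | T ω < t} = ENNReal.ofReal (t - a) := by
  rw [hT.measure_eq (p := fun x => x < t) measurableSet_Iio, cond_volume_Icc hab]
  change volume.restrict (Set.Icc a b) (Set.Iio t) = _
  have : Set.Iio t ∩ Set.Icc a b = Set.Ico a t := by
    ext x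
    simp only [Set.mem_inter_iff, Set.mem_Iio, Set.mem_Icc, Set.mem_Ico]
    exact ⟨fun h => ⟨h.2.1, h.1⟩, fun h => ⟨h.2, h.1, h.2.le.trans ht.2⟩⟩
  rw [Measure.restrict_apply measurableSet_Iio, this, Real.volume_Ico]

/-- The marks which decide on the access of AP `i`, in groups of three for each other AP. -/
def marksW (i : ℕ) : Option ℕ × Fin 3 → Mark
  | (none, 0) => .timerW i
  | (none, 1) => .timerL 0
  | (none, 2) => .timerL 1
  -- For `j = i` the timer already heads the group at `none`, so an unused eNB timer replaces it to
  -- keep the labelling injective.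
  | (some j, 0) => if j = i then .timerL 2 else .timerW j
  | (some j, 1) => .fadeW j i
  | (some j, 2) => .fadeLW 0 j

lemma marksW_injective (i : ℕ) : Function.Injective (marksW i) := by
  rintro ⟨_ | j, q⟩ ⟨_ | k, r⟩ <;> fin_cases q <;> fin_cases r <;>
    simp only [marksW] <;> (try split_ifs) <;> (simp_all; try omega)

/-- The marks which decide on the access of eNB `k`, in groups of three for each index of an
AP and another eNB. -/
def marksL (k : ℕ) : Option ℕ × Fin 3 → Mark
  | (none, 0) => .timerL k
  | (none, 1) => .timerW 0
  | (none, 2) => .timerW 1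
  | (some j, 0) => if j = k then .timerW 2 else .timerL j
  | (some j, 1) => .fadeL j k
  | (some j, 2) => .fadeWL j k

lemma marksL_injective (k : ℕ) : Function.Injective (marksL k) := by
  rintro ⟨_ | j, q⟩ ⟨_ | k, r⟩ <;> fin_cases q <;> fin_cases r <;>
    simp only [marksL] <;> (try split_ifs) <;> (simp_all; try omega)

lemma one_sub_ofReal_mul {x y : ℝ} (hx : 0 ≤ x) (hy : 0 ≤ y) :
    1 - ENNReal.ofReal x * ENNReal.ofReal y = ENNReal.ofReal (1 - x * y) := by
  rw [← ENNReal.ofReal_mul hx, ENNReal.ofReal_sub _ (by positivity), ENNReal.ofReal_one]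

lemma measurableSet_div_le (l θ : ℝ) : MeasurableSet {g : ℝ | g / l ≤ θ} :=
  measurableSet_le (by fun_prop) measurable_const

variable {p : Params} {X Y : ℕ → Ω → Plane} {Z : Mark → Ω → ℝ}

/-- Only one fading per competitor matters here, so the third mark of each group is left
unconstrained by `U = Set.univ`. -/
lemma IsNetwork.measure_access_AP [IsProbabilityMeasure P] (h : IsNetwork P p 1 2 X Y Z) (i : ℕ)
    {d : ℕ → ℝ} (hd : ∀ j, 0 ≤ d j) {θ : ℝ} (hθ : 0 ≤ θ) :
    P {ω | ∀ j, j = i ∨ Z (.timerW i) ω ≤ Z (.timerW j) ω ∨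
        Z (.fadeW j i) ω / p.pathLoss (d j) ≤ θ} =
      ∫⁻ t in Set.Icc 0 1, seqProd fun j => if j = i then 1 else
        ENNReal.ofReal (1 - t * p.detect θ (d j)) := by
  have key := measure_forall_access h.measurable_mark h.indep_mark (marksW_injective i) i
    (K := fun j => {g | g / p.pathLoss (d j) ≤ θ}) (U := fun _ => Set.univ)
    (fun j => measurableSet_div_le _ _) (fun _ => .univ)
  have hset : {ω | ∀ j, (j = i ∨ Z (marksW i (none, 0)) ω ≤ Z (marksW i (some j, 0)) ω ∨
      Z (marksW i (some j, 1)) ω ∈ {g | g / p.pathLoss (d j) ≤ θ}) ∧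
        Z (marksW i (some j, 2)) ω ∈ Set.univ} =
      {ω | ∀ j, j = i ∨ Z (.timerW i) ω ≤ Z (.timerW j) ω ∨
        Z (.fadeW j i) ω / p.pathLoss (d j) ≤ θ} := by
    ext ω
    refine forall_congr' fun j => ?_
    by_cases hj : j = i <;> simp [hj, marksW]
  have hlaw : P.map (Z (marksW i (none, 0))) = volume.restrict (Set.Icc 0 1) :=
    (h.law_mark (.timerW i)).map_eq.trans (cond_volume_Icc (by norm_num))
  rw [hset, hlaw] at key
  rw [key]
  refine setLIntegral_congr_fun measurableSet_Icc fun t ht => congrArg seqProd (funext fun j => ?_)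
  simp only [Set.mem_univ, Set.ofPred_true, measure_univ, mul_one]
  split_ifs with hj
  · rfl
  · have hT : P {ω | Z (marksW i (some j, 0)) ω < t} = ENNReal.ofReal t := by
      simp only [marksW, if_neg hj]
      rw [measure_timer_lt (by norm_num) (h.law_mark (.timerW j)) ht, sub_zero]
    have hG := measure_fading p (h.law_mark (.fadeW j i)) hθ (hd j)
    rw [hT, ← one_sub_ofReal_mul ht.1 (p.detect_mem hθ (hd j)).1, ← hG]
    rfl

/-- AP `j` and eNB `j` share the group of index `j`. The AP factor carries no timer, since APs
always come first; it is also present at `j = k`, where only the eNB factor is dropped. -/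
lemma IsNetwork.measure_access_eNB [IsProbabilityMeasure P] (h : IsNetwork P p 1 2 X Y Z) (k : ℕ)
    {d d' : ℕ → ℝ} (hd : ∀ j, 0 ≤ d j) (hd' : ∀ j, 0 ≤ d' j) {θ θ' : ℝ} (hθ : 0 ≤ θ)
    (hθ' : 0 ≤ θ') :
    P {ω | ∀ j, (j = k ∨ Z (.timerL k) ω ≤ Z (.timerL j) ω ∨
        Z (.fadeL j k) ω / p.pathLoss (d j) ≤ θ) ∧ Z (.fadeWL j k) ω / p.pathLoss (d' j) ≤ θ'} =
      ∫⁻ t in Set.Icc 1 2, seqProd fun j => (if j = k then 1 else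
        ENNReal.ofReal (1 - (t - 1) * p.detect θ (d j))) *
          ENNReal.ofReal (1 - p.detect θ' (d' j)) := by
  have key := measure_forall_access h.measurable_mark h.indep_mark (marksL_injective k) k
    (K := fun j => {g | g / p.pathLoss (d j) ≤ θ}) (U := fun j => {g | g / p.pathLoss (d' j) ≤ θ'})
    (fun j => measurableSet_div_le _ _) (fun _ => measurableSet_div_le _ _)
  have hset : {ω | ∀ j, (j = k ∨ Z (marksL k (none, 0)) ω ≤ Z (marksL k (some j, 0)) ω ∨
      Z (marksL k (some j, 1)) ω ∈ {g | g / p.pathLoss (d j) ≤ θ}) ∧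
        Z (marksL k (some j, 2)) ω ∈ {g | g / p.pathLoss (d' j) ≤ θ'}} =
      {ω | ∀ j, (j = k ∨ Z (.timerL k) ω ≤ Z (.timerL j) ω ∨
        Z (.fadeL j k) ω / p.pathLoss (d j) ≤ θ) ∧
          Z (.fadeWL j k) ω / p.pathLoss (d' j) ≤ θ'} := by
    ext ω
    refine forall_congr' fun j => ?_
    by_cases hj : j = k <;> simp [hj, marksL]
  have hlaw : P.map (Z (marksL k (none, 0))) = volume.restrict (Set.Icc 1 2) :=
    (h.law_mark (.timerL k)).map_eq.trans (cond_volume_Icc (by norm_num))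
  rw [hset, hlaw] at key
  rw [key]
  refine setLIntegral_congr_fun measurableSet_Icc fun t ht => congrArg seqProd (funext fun j => ?_)
  have hG' := measure_fading p (h.law_mark (.fadeWL j k)) hθ' (hd' j)
  have hGm : MeasurableSet {ω | Z (.fadeWL j k) ω ∉ {g | g / p.pathLoss (d' j) ≤ θ'}} :=
    h.measurable_mark _ (measurableSet_div_le _ _).compl
  have hU : P {ω | Z (marksL k (some j, 2)) ω ∈ {g | g / p.pathLoss (d' j) ≤ θ'}} =
      ENNReal.ofReal (1 - p.detect θ' (d' j)) := by
    have := prob_compl_eq_one_sub (μ := P) hGm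
    rw [hG', ← ENNReal.ofReal_one, ← ENNReal.ofReal_sub _ (p.detect_mem hθ' (hd' j)).1] at this
    rw [← this]
    congr 1
    ext ω
    simp [marksL]
  rw [hU]
  congr 1
  split_ifs with hj
  · rfl
  · have hT : P {ω | Z (marksL k (some j, 0)) ω < t} = ENNReal.ofReal (t - 1) := by
      simp only [marksL, if_neg hj]
      exact measure_timer_lt (by norm_num) (h.law_mark (.timerL j)) ht
    have hG := measure_fading p (h.law_mark (.fadeL j k)) hθ (hd j)
    rw [hT, ← one_sub_ofReal_mul (by linarith [ht.1]) (p.detect_mem hθ (hd j)).1, ← hG]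
    rfl

end Laws

/-! ### Integrability, positivity and invariance of the detection kernel. -/

section Kernel

variable (p : Params) {θ : ℝ}

lemma Params.continuous_exp_pathLoss (θ : ℝ) :
    Continuous fun d : ℝ => Real.exp (-p.μ * θ * p.pathLoss d) := by
  unfold Params.pathLoss
  have : Continuous fun d : ℝ => d ^ p.α := Real.continuous_rpow_const p.α_pos.le
  fun_prop

lemma Params.integrable_exp_pathLoss_norm (hθ : 0 < θ) :
    Integrable fun x : Plane => Real.exp (-p.μ * θ * p.pathLoss ‖x‖) := by
  rw [integrable_fun_norm_addHaar volume (f := fun d => Real.exp (-p.μ * θ * p.pathLoss d))]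
  set b := p.μ * θ * (4 * Real.pi / p.lamc) ^ 2 with hb
  have hb0 : 0 < b := by
    have := p.μ_pos; have := p.lamc_pos
    positivity
  have hI := integral_rpow_mul_exp_neg_mul_rpow (q := 1) p.α_pos (by norm_num) hb0
  -- In polar coordinates the kernel is a Gamma integral. Its nonzero value gives integrability,
  -- because the Bochner integral of a non-integrable function is 0.
  have hne : ∫ x in Set.Ioi (0 : ℝ), x ^ (1 : ℝ) * Real.exp (-b * x ^ p.α) ≠ 0 := by
    rw [hI]
    have := p.α_pos
    have := Real.Gamma_pos_of_pos (s := (1 + 1) / p.α) (by positivity)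
    positivity
  refine (Integrable.of_integral_ne_zero hne).congr (.of_forall fun x => ?_)
  simp only [finrank_euclideanSpace, Fintype.card_fin, Nat.add_one_sub_one, pow_one, smul_eq_mul,
    Real.rpow_one, Params.pathLoss, hb]
  congr 2; ring

lemma Params.integrable_exp_pathLoss (hθ : 0 < θ) (y : Plane) :
    Integrable fun x : Plane => Real.exp (-p.μ * θ * p.pathLoss ‖x - y‖) :=
  (p.integrable_exp_pathLoss_norm hθ).comp_sub_right y

/-- The integral of the detection probability at `y` over the complement of a ball. -/
def Params.detectArea (θ : ℝ) (y : Plane) (r : ℝ) : ℝ :=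
  ∫ x in (Metric.closedBall (0 : Plane) r)ᶜ, Real.exp (-p.μ * θ * p.pathLoss ‖x - y‖)

lemma Params.detectArea_pos (hθ : 0 < θ) (y : Plane) (r : ℝ) : 0 < p.detectArea θ y r := by
  have hne : NeZero (volume.restrict (Metric.closedBall (0 : Plane) r)ᶜ) := by
    refine ⟨fun h0 => ?_⟩
    rw [Measure.restrict_eq_zero] at h0
    have h1 : volume (Set.univ : Set Plane) ≤ volume (Metric.closedBall (0 : Plane) r) +
        volume (Metric.closedBall (0 : Plane) r)ᶜ := by
      rw [← Set.union_compl_self (Metric.closedBall (0 : Plane) r)]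
      exact measure_union_le _ _
    rw [h0, add_zero, measure_univ_of_isAddLeftInvariant] at h1
    exact absurd h1 (not_le.2 measure_closedBall_lt_top)
  exact integral_exp_pos (p.integrable_exp_pathLoss hθ y).integrableOn

lemma exists_isometry_map {x y : Plane} (h : ‖x‖ = ‖y‖) : ∃ e : Plane ≃ₗᵢ[ℝ] Plane, e x = y :=
  ⟨(Submodule.span ℝ {x - y})ᗮ.reflection, Submodule.reflection_sub h⟩

/-- The reflection exchanging two points of equal norm preserves area, distances and the centred
ball. -/
lemma Params.detectArea_congr_norm {x y : Plane} (h : ‖x‖ = ‖y‖) (r : ℝ) :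
    p.detectArea θ x r = p.detectArea θ y r := by
  obtain ⟨e, he⟩ := exists_isometry_map h
  have hpre : e ⁻¹' (Metric.closedBall (0 : Plane) r)ᶜ = (Metric.closedBall (0 : Plane) r)ᶜ := by
    ext z; simp
  have := e.measurePreserving.setIntegral_preimage_emb
    e.toHomeomorph.toMeasurableEquiv.measurableEmbedding
    (fun z => Real.exp (-p.μ * θ * p.pathLoss ‖z - y‖)) (Metric.closedBall (0 : Plane) r)ᶜ
  rw [hpre] at this
  rw [detectArea, detectArea, ← this]
  refine integral_congr_ae (.of_forall fun z => ?_)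
  simp only
  rw [← he, ← map_sub, e.norm_map]

lemma Params.measurable_detectArea (θ : ℝ) :
    Measurable fun r : ℝ => p.detectArea θ !₂[r, 0] r := by
  have hpt : Measurable fun r : ℝ => (!₂[r, 0] : Plane) := by
    have : Continuous fun r : ℝ => (!₂[r, 0] : Plane) :=
      (PiLp.continuous_toLp 2 _).comp (by fun_prop)
    exact this.measurable
  have hm : Measurable (Function.uncurry fun (r : ℝ) (x : Plane) => if ‖x‖ ≤ r then 0 else
      Real.exp (-p.μ * θ * p.pathLoss ‖x - !₂[r, 0]‖)) := by
    refine Measurable.ite (measurableSet_le measurable_snd.norm measurable_fst) measurable_const ?_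
    exact (p.continuous_exp_pathLoss θ).measurable.comp
      (measurable_snd.sub (hpt.comp measurable_fst)).norm
  have := (StronglyMeasurable.integral_prod_right (ν := volume) hm.stronglyMeasurable).measurable
  convert! this using 1
  ext r
  rw [detectArea, ← integral_indicator Metric.isClosed_closedBall.measurableSet.compl]
  refine integral_congr_ae (.of_forall fun x => ?_)
  by_cases hx : ‖x‖ ≤ r <;> simp [hx]

/-- `detect` differs from the exponential kernel only at the single point `x = y`, and translation
removes `y`. This independence of `y` lets the AP factor leave the integral over the eNB location.
-/
lemma Params.integral_detect (θ : ℝ) (y : Plane) :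
    ∫ x, p.detect θ ‖y - x‖ = p.detectArea θ 0 0 := by
  have h1 : ∫ x, p.detect θ ‖y - x‖ = ∫ x, Real.exp (-p.μ * θ * p.pathLoss ‖y - x‖) := by
    refine integral_congr_ae ?_
    filter_upwards [compl_mem_ae_iff.2 (measure_singleton y)] with x hx
    rw [detect, if_neg (norm_ne_zero_iff.2 (sub_ne_zero.2 fun e => hx e.symm))]
  rw [h1, integral_sub_left_eq_self (fun z => Real.exp (-p.μ * θ * p.pathLoss ‖z‖)) volume y,
    detectArea]
  simp only [sub_zero, Metric.closedBall_zero, restrict_compl_singleton]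

lemma Params.measurable_detect (θ : ℝ) : Measurable (p.detect θ) :=
  measurable_const.ite (measurableSet_singleton 0) (p.continuous_exp_pathLoss θ).measurable

lemma Params.integrable_detect (hθ : 0 < θ) (y : Plane) :
    Integrable fun x : Plane => p.detect θ ‖y - x‖ := by
  refine (p.integrable_exp_pathLoss hθ y).mono'
    ((p.measurable_detect θ).comp (by fun_prop)).aestronglyMeasurable (.of_forall fun x => ?_)
  rw [Real.norm_of_nonneg (p.detect_mem hθ.le (norm_nonneg _)).1, detect, norm_sub_rev]
  split_ifs
  exacts [(Real.exp_pos _).le, le_rfl]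

end Kernel

/-! ### Integration over the timer and over the distance of the closest point. -/

section Integrals

lemma lintegral_exp_timer (a : ℝ) {b N : ℝ} (hb : b = a + 1) (hN : 0 < N) :
    ∫⁻ t in Set.Icc a b, ENNReal.ofReal (Real.exp (-((t - a) * N))) =
      ENNReal.ofReal ((1 - Real.exp (-N)) / N) := by
  have hc : Continuous fun t => Real.exp (-((t - a) * N)) := by fun_prop
  rw [← ofReal_integral_eq_lintegral_ofReal hc.integrableOn_Icc
    (.of_forall fun t => (Real.exp_pos _).le), integral_Icc_eq_integral_Ioc,
    ← intervalIntegral.integral_of_le (by linarith)]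
  congr 1
  have hd : ∀ t ∈ Set.uIcc a b, HasDerivAt (fun t => -Real.exp (-((t - a) * N)) / N)
      (Real.exp (-((t - a) * N))) t := fun t _ => by
    have h1 : HasDerivAt (fun t : ℝ => -((t - a) * N)) (-(1 * N)) t :=
      (((hasDerivAt_id t).sub_const a).mul_const N).neg
    convert! (h1.exp.neg.div_const N) using 1
    field_simp
  rw [intervalIntegral.integral_eq_sub_of_hasDerivAt hd (hc.intervalIntegrable _ _), hb]
  simp only [add_sub_cancel_left, sub_self, one_mul, zero_mul, neg_zero, Real.exp_zero]
  ring

lemma one_sub_exp_neg_div_mem {N : ℝ} (hN : 0 < N) :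
    (1 - Real.exp (-N)) / N ∈ Set.Icc (0 : ℝ) 1 := by
  constructor
  · have : Real.exp (-N) ≤ 1 := Real.exp_le_one_iff.2 (by linarith)
    exact div_nonneg (by linarith) hN.le
  · rw [div_le_one hN]
    linarith [Real.add_one_le_exp (-N)]

variable {lam : ℝ} {q : ℝ → ℝ}

lemma integrable_gaussian_mul (hlam : 0 < lam) (hq : Measurable q)
    (hq' : ∀ r, 0 ≤ r → q r ∈ Set.Icc (0 : ℝ) 1) :
    Integrable fun x : Plane => lam * Real.exp (-(lam * (Real.pi * ‖x‖ ^ 2))) * q ‖x‖ := by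
  refine (integrable_gaussian_plane hlam).mono' (by fun_prop) (.of_forall fun x => ?_)
  have := hq' ‖x‖ (norm_nonneg x)
  rw [Real.norm_of_nonneg (mul_nonneg (by positivity) this.1)]
  exact mul_le_of_le_one_right (by positivity) this.2

lemma integrableOn_mul_density (hlam : 0 < lam) (hq : Measurable q)
    (hq' : ∀ r, 0 ≤ r → q r ∈ Set.Icc (0 : ℝ) 1) :
    IntegrableOn (fun r => q r * (lam * 2 * Real.pi * r * Real.exp (-lam * Real.pi * r ^ 2)))
      (Set.Ioi 0) := by
  have h := (integrable_fun_norm_addHaar (E := Plane) volume (f := fun r =>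
    lam * Real.exp (-(lam * (Real.pi * r ^ 2))) * q r)).1 (integrable_gaussian_mul hlam hq hq')
  refine (h.const_mul (2 * Real.pi)).congr (.of_forall fun r => ?_)
  simp only [finrank_euclideanSpace, Fintype.card_fin, Nat.add_one_sub_one, pow_one, smul_eq_mul]
  rw [show -(lam * (Real.pi * r ^ 2)) = -lam * Real.pi * r ^ 2 by ring]
  ring

lemma lintegral_gaussian_mul (hlam : 0 < lam) (hq : Measurable q)
    (hq' : ∀ r, 0 ≤ r → q r ∈ Set.Icc (0 : ℝ) 1) :
    ∫⁻ x : Plane, ENNReal.ofReal (lam * Real.exp (-(lam * (Real.pi * ‖x‖ ^ 2)))) *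
        ENNReal.ofReal (q ‖x‖) =
      ENNReal.ofReal (∫ r in Set.Ioi (0 : ℝ),
        q r * (lam * 2 * Real.pi * r * Real.exp (-lam * Real.pi * r ^ 2))) := by
  have h1 : ∀ x : Plane, 0 ≤ lam * Real.exp (-(lam * (Real.pi * ‖x‖ ^ 2))) := fun x => by
    positivity
  simp_rw [← ENNReal.ofReal_mul (h1 _)]
  rw [← ofReal_integral_eq_lintegral_ofReal (integrable_gaussian_mul hlam hq hq')
    (.of_forall fun x => mul_nonneg (h1 x) (hq' _ (norm_nonneg x)).1),
    integral_fun_norm_addHaar volume (fun r => lam * Real.exp (-(lam * (Real.pi * r ^ 2))) * q r)]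
  congr 1
  have hball : volume.real (Metric.ball (0 : Plane) 1) = Real.pi := by
    rw [← Measure.addHaar_real_closedBall_eq_addHaar_real_ball, volume_real_closedBall zero_le_one]
    simp
  rw [hball, ← integral_smul, nsmul_eq_mul, ← integral_const_mul]
  refine integral_congr_ae (.of_forall fun r => ?_)
  simp only [finrank_euclideanSpace, Fintype.card_fin, Nat.add_one_sub_one, pow_one, smul_eq_mul]
  rw [show -(lam * (Real.pi * r ^ 2)) = -lam * Real.pi * r ^ 2 by ring]
  push_cast
  ring

end Integrals

/-! ### Access as an event, order of the timers, and conditioning on the locations. -/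

section Access

lemma accessFactor_eq (p : Params) (t' t G d Γ Q : ℝ)
    [Decidable (t ≤ t' ∨ G / p.pathLoss d ≤ Γ / Q)] :
    accessFactor p t' t G d Γ Q = if t ≤ t' ∨ G / p.pathLoss d ≤ Γ / Q then 1 else 0 := by
  unfold accessFactor
  by_cases h1 : t ≤ t'
  · simp [h1, not_lt.2 h1]
  · by_cases h2 : G / p.pathLoss d ≤ Γ / Q <;> simp [h1, not_le.1 h1, h2]

lemma tprod_ite_one_zero {ι : Type*} (A : ι → Prop) [DecidablePred A] [Decidable (∀ j, A j)] :
    ∏' j, (if A j then 1 else 0 : ℝ) = if ∀ j, A j then 1 else 0 := by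
  split_ifs with h
  · simp [h]
  · push Not at h
    obtain ⟨j, hj⟩ := h
    exact tprod_of_exists_eq_zero ⟨j, if_neg hj⟩

lemma ite_mul_ite_eq_one_iff (A B : Prop) [Decidable A] [Decidable B] :
    (if A then 1 else 0 : ℝ) * (if B then 1 else 0) = 1 ↔ A ∧ B := by
  split_ifs <;> simp_all

variable {Ω : Type*} {p : Params} {X Y : ℕ → Ω → Plane} {Z : Mark → Ω → ℝ}

lemma accessW_eq_one_iff (i : ℕ) (ω : Ω) : accessW p X Y Z i ω = 1 ↔
    (∀ j, j = i ∨ Z (.timerW i) ω ≤ Z (.timerW j) ω ∨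
      Z (.fadeW j i) ω / p.pathLoss ‖X j ω - X i ω‖ ≤ p.Γcs / p.PW) ∧
    ∀ m, Z (.timerW i) ω ≤ Z (.timerL m) ω ∨
      Z (.fadeLW m i) ω / p.pathLoss ‖Y m ω - X i ω‖ ≤ p.Γed / p.PL := by
  classical
  simp only [accessW, accessFactor_eq]
  rw [tprod_ite_one_zero, tprod_ite_one_zero, ite_mul_ite_eq_one_iff, Subtype.forall]
  simp only [ne_eq, or_iff_not_imp_left]

lemma accessL_eq_one_iff (k : ℕ) (ω : Ω) : accessL p X Y Z k ω = 1 ↔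
    (∀ j, Z (.timerL k) ω ≤ Z (.timerW j) ω ∨
      Z (.fadeWL j k) ω / p.pathLoss ‖Y k ω - X j ω‖ ≤ p.ΓL / p.PW) ∧
    ∀ m, m = k ∨ Z (.timerL k) ω ≤ Z (.timerL m) ω ∨
      Z (.fadeL m k) ω / p.pathLoss ‖Y m ω - Y k ω‖ ≤ p.ΓL / p.PL := by
  classical
  simp only [accessL, accessFactor_eq]
  rw [tprod_ite_one_zero, tprod_ite_one_zero, ite_mul_ite_eq_one_iff, Subtype.forall]
  simp only [ne_eq, or_iff_not_imp_left]

variable [MeasurableSpace Ω] {P : Measure Ω}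

lemma IsNetwork.ae_timerW_le (h : IsNetwork P p 1 2 X Y Z) :
    ∀ᵐ ω ∂P, ∀ i, Z (.timerW i) ω ≤ 1 := by
  refine ae_all_iff.2 fun i => ?_
  refine ((h.law_mark (.timerW i)).ae_iff (p := fun t => t ≤ 1) (by fun_prop)).2 ?_
  change ∀ᵐ t ∂(cond volume (Set.Icc (0 : ℝ) 1)), t ≤ 1
  rw [cond_volume_Icc (by norm_num)]
  exact (ae_restrict_mem measurableSet_Icc).mono fun t ht => ht.2

lemma IsNetwork.ae_one_lt_timerL (h : IsNetwork P p 1 2 X Y Z) :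
    ∀ᵐ ω ∂P, ∀ k, 1 < Z (.timerL k) ω := by
  refine ae_all_iff.2 fun k => ?_
  refine ((h.law_mark (.timerL k)).ae_iff (p := fun t => 1 < t) (by fun_prop)).2 ?_
  change ∀ᵐ t ∂(cond volume (Set.Icc (1 : ℝ) 2)), 1 < t
  rw [cond_volume_Icc (by norm_num)]
  filter_upwards [ae_restrict_mem measurableSet_Icc,
    ae_restrict_of_ae (compl_mem_ae_iff.2 (measure_singleton (1 : ℝ)))] with t ht ht'
  exact lt_of_le_of_ne ht.1 fun e => ht' e.symm

/-- Conditioning on the locations. -/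
lemma IsNetwork.measure_eq_lintegral [IsProbabilityMeasure P] {a b : ℝ}
    (h : IsNetwork P p a b X Y Z)
    {S : Set (((ℕ → Plane) × (ℕ → Plane)) × (Mark → ℝ))} (hS : MeasurableSet S) :
    P {ω | (((fun i => X i ω), (fun k => Y k ω)), fun m => Z m ω) ∈ S} =
      ∫⁻ ω, P {ω' | (((fun i => X i ω), (fun k => Y k ω)), fun m => Z m ω') ∈ S} ∂P := by
  have hL : Measurable fun ω => ((fun i => X i ω), (fun k => Y k ω)) :=
    (measurable_pi_lambda _ h.pppW.measurable).prodMk (measurable_pi_lambda _ h.pppL.measurable)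
  have hM : Measurable fun ω m => Z m ω := measurable_pi_lambda _ h.measurable_mark
  have h1 : P {ω | (((fun i => X i ω), (fun k => Y k ω)), fun m => Z m ω) ∈ S} =
      P.map (fun ω => (((fun i => X i ω), (fun k => Y k ω)), fun m => Z m ω)) S :=
    (Measure.map_apply (hL.prodMk hM) hS).symm
  rw [h1, (indepFun_iff_map_prod_eq_prod_map_map hL.aemeasurable hM.aemeasurable).1
    h.indep_loc_mark, Measure.prod_apply hS, lintegral_map (measurable_measure_prodMk_left hS) hL]
  refine lintegral_congr fun ω => ?_
  rw [Measure.map_apply hM (measurable_prodMk_left hS)]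
  rfl

lemma IsNetwork.lintegral_locations [IsProbabilityMeasure P] {a b : ℝ}
    (h : IsNetwork P p a b X Y Z) {H : (ℕ → Plane) × (ℕ → Plane) → ℝ≥0∞} (hH : Measurable H) :
    ∫⁻ ω, H ((fun i => X i ω), (fun k => Y k ω)) ∂P =
      ∫⁻ ω, ∫⁻ ω', H ((fun i => X i ω'), (fun k => Y k ω)) ∂P ∂P := by
  have hX := measurable_pi_lambda (fun ω i => X i ω) h.pppW.measurable
  have hY := measurable_pi_lambda (fun ω k => Y k ω) h.pppL.measurable
  rw [← lintegral_map hH (hX.prodMk hY),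
    (indepFun_iff_map_prod_eq_prod_map_map hX.aemeasurable hY.aemeasurable).1 h.indepWL,
    lintegral_prod_symm' _ hH, lintegral_map ?_ hY]
  · refine lintegral_congr fun ω => ?_
    exact lintegral_map (f := fun x => H (x, fun k => Y k ω))
      (hH.comp measurable_prodMk_right) hX
  · exact hH.lintegral_prod_left'

end Access

/-! ### Averaging the own-system product over locations and timer. -/

section Survival

variable (p : Params)

/-- Probability that a transmitter at `y`, audible with probability `s`, does not silence a
node at `x`. -/
def Params.survive (θ s : ℝ) (x y : Plane) : ℝ :=
  1 - s * Real.exp (-p.μ * θ * p.pathLoss ‖y - x‖)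

lemma Params.continuous_survive (θ : ℝ) :
    Continuous fun q : ℝ × Plane × Plane => p.survive θ q.1 q.2.1 q.2.2 := by
  unfold Params.survive
  have := (p.continuous_exp_pathLoss θ).comp
    (f := fun q : ℝ × Plane × Plane => ‖q.2.2 - q.2.1‖) (by fun_prop)
  exact continuous_const.sub (continuous_fst.mul this)

lemma Params.survive_mem {θ s : ℝ} (hθ : 0 ≤ θ) (hs : s ∈ Set.Icc (0 : ℝ) 1) (x y : Plane) :
    p.survive θ s x y ∈ Set.Icc (0 : ℝ) 1 := by
  have h := p.exp_mem hθ (norm_nonneg (y - x))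
  have := mul_le_one₀ hs.2 h.1 h.2
  have := mul_nonneg hs.1 h.1
  unfold Params.survive
  constructor <;> linarith

variable {Ω : Type*} [MeasurableSpace Ω] {P : Measure Ω} {lam : ℝ} {X : ℕ → Ω → Plane}

lemma measurable_palmProd_survive (hX : ∀ i, Measurable (X i)) (θ a : ℝ) :
    Measurable (Function.uncurry fun (t : ℝ) ω => palmProd X (p.survive θ (t - a)) ω) := by
  refine measurable_seqProd fun j => Measurable.ite ?_ measurable_const ?_
  · exact measurableSet_eq_fun measurable_const ((measurable_tagged hX).comp measurable_snd)
  · exact ((p.continuous_survive θ).measurable.comp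
      ((measurable_fst.sub_const a).prodMk
        (((measurable_tagged_point hX).comp measurable_snd).prodMk
          ((hX j).comp measurable_snd)))).ennreal_ofReal

lemma IsHomogeneousPPP.lintegral_palmProd_survive [IsProbabilityMeasure P]
    (h : IsHomogeneousPPP P lam X) (hlam : 0 < lam) {θ : ℝ} (hθ : 0 < θ) {s : ℝ}
    (hs : s ∈ Set.Icc (0 : ℝ) 1) :
    ∫⁻ ω, palmProd X (p.survive θ s) ω ∂P =
      ∫⁻ x : Plane, ENNReal.ofReal (lam * Real.exp (-(lam * (Real.pi * ‖x‖ ^ 2)))) *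
        ENNReal.ofReal (Real.exp (-(s * (lam * p.detectArea θ !₂[‖x‖, 0] ‖x‖)))) := by
  have hc := p.continuous_survive θ
  have e : ∀ x y, 1 - p.survive θ s x y = s * Real.exp (-p.μ * θ * p.pathLoss ‖y - x‖) :=
    fun x y => sub_sub_cancel _ _
  have hm : Measurable (Function.uncurry (p.survive θ s)) :=
    (hc.comp (f := fun q : Plane × Plane => (s, q.1, q.2)) (by fun_prop)).measurable
  rw [h.lintegral_palmProd hlam hm
    (p.survive_mem hθ.le hs)
    (fun y => hc.comp (f := fun x : Plane => (s, x, y)) (by fun_prop))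
    (fun x => by simp_rw [e]; exact (p.integrable_exp_pathLoss hθ x).const_mul s)]
  refine lintegral_congr fun x => ?_
  simp_rw [e]
  have hx : ‖x‖ = ‖(!₂[‖x‖, 0] : Plane)‖ := by
    simp [EuclideanSpace.norm_eq]
  rw [integral_const_mul, ← p.detectArea_congr_norm hx, Params.detectArea]
  congr 4; ring

/-- Access probability with respect to the transmitters of its own system, for the node closest
to the origin. -/
lemma IsHomogeneousPPP.lintegral_timer_palmProd [IsProbabilityMeasure P]
    (h : IsHomogeneousPPP P lam X) (hlam : 0 < lam) {θ : ℝ} (hθ : 0 < θ) {a b : ℝ}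
    (hb : b = a + 1) :
    ∫⁻ t in Set.Icc a b, ∫⁻ ω, palmProd X (p.survive θ (t - a)) ω ∂P =
      ENNReal.ofReal (∫ r in Set.Ioi (0 : ℝ),
        (1 - Real.exp (-(lam * p.detectArea θ !₂[r, 0] r))) / (lam * p.detectArea θ !₂[r, 0] r) *
          (lam * 2 * Real.pi * r * Real.exp (-lam * Real.pi * r ^ 2))) := by
  have hN : ∀ r, 0 < lam * p.detectArea θ !₂[r, 0] r := fun r =>
    mul_pos hlam (p.detectArea_pos hθ _ _)
  have hNm : Measurable fun r => lam * p.detectArea θ !₂[r, 0] r :=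
    (p.measurable_detectArea θ).const_mul lam
  rw [← lintegral_gaussian_mul hlam (by fun_prop) fun r _ => one_sub_exp_neg_div_mem (hN r),
    setLIntegral_congr_fun measurableSet_Icc fun t ht => h.lintegral_palmProd_survive p hlam hθ
      ⟨by linarith [ht.1], by linarith [ht.2]⟩, lintegral_lintegral_swap]
  · refine lintegral_congr fun x => ?_
    rw [lintegral_const_mul _ (by fun_prop), lintegral_exp_timer a hb (hN _)]
  · have : Measurable fun x : Plane => lam * p.detectArea θ !₂[‖x‖, 0] ‖x‖ :=
      hNm.comp measurable_norm
    have h2 : Measurable fun q : ℝ × Plane =>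
        (q.1 - a) * (lam * p.detectArea θ !₂[‖q.2‖, 0] ‖q.2‖) :=
      (measurable_fst.sub_const a).mul (this.comp measurable_snd)
    have h3 : Measurable fun q : ℝ × Plane =>
        ENNReal.ofReal (lam * Real.exp (-(lam * (Real.pi * ‖q.2‖ ^ 2)))) := by fun_prop
    exact (h3.mul h2.neg.exp.ennreal_ofReal).aemeasurable

end Survival

/-! ### The access probabilities of the two tagged nodes. -/

section Main

lemma measurable_apply_index {β γ : Type*} [MeasurableSpace β] [MeasurableSpace γ]
    {f : ℕ → β → γ} (hf : ∀ i, Measurable (f i)) {n : β → ℕ} (hn : Measurable n) :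
    Measurable fun b => f (n b) b := by
  have : Measurable fun q : ℕ × β => f q.1 q.2 := measurable_from_prod_countable_right hf
  exact this.comp (hn.prodMk measurable_id)

lemma Params.measurable_pathLoss (p : Params) : Measurable p.pathLoss := by
  unfold Params.pathLoss
  fun_prop

variable {Ω : Type*} [MeasurableSpace Ω] {P : Measure Ω} {p : Params} {X Y : ℕ → Ω → Plane}
  {Z : Mark → Ω → ℝ}

/-- Locations of APs and eNBs, together with the marks. -/
abbrev Config : Type := ((ℕ → Plane) × (ℕ → Plane)) × (Mark → ℝ)

/-- Locations and marks for which AP `nearest` is not silenced by the other APs. -/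
def accessSetW (p : Params) : Set Config :=
  {q | ∀ j, j = nearest q.1.1 ∨ q.2 (.timerW (nearest q.1.1)) ≤ q.2 (.timerW j) ∨
    q.2 (.fadeW j (nearest q.1.1)) / p.pathLoss ‖q.1.1 j - q.1.1 (nearest q.1.1)‖ ≤ p.Γcs / p.PW}

lemma measurableSet_accessSetW (p : Params) : MeasurableSet (accessSetW p) := by
  have hn : Measurable fun q : Config => nearest q.1.1 := measurable_nearest.comp (by fun_prop)
  have hx : Measurable fun q : Config => q.1.1 (nearest q.1.1) :=
    measurable_apply_index (f := fun i (q : Config) => q.1.1 i) (fun i => by fun_prop) hn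
  have ht : Measurable fun q : Config => q.2 (.timerW (nearest q.1.1)) :=
    measurable_apply_index (f := fun i (q : Config) => q.2 (.timerW i)) (fun i => by fun_prop) hn
  rw [accessSetW, Set.ofPred_forall]
  refine .iInter fun j => ?_
  have hf : Measurable fun q : Config => q.2 (.fadeW j (nearest q.1.1)) :=
    measurable_apply_index (f := fun i (q : Config) => q.2 (.fadeW j i)) (fun i => by fun_prop) hn
  have hxj : Measurable fun q : Config => q.1.1 j := by fun_prop
  have htj : Measurable fun q : Config => q.2 (.timerW j) := by fun_prop
  have h1 := measurableSet_le ht htj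
  have h2 := measurableSet_le (hf.div (p.measurable_pathLoss.comp (hxj.sub hx).norm))
    (measurable_const (a := p.Γcs / p.PW))
  exact (measurableSet_eq_fun measurable_const hn).union (h1.union h2)

/-- Locations and marks for which eNB `nearest` hears no AP and is not silenced by the other
eNBs. -/
def accessSetL (p : Params) : Set Config :=
  {q | ∀ j, (j = nearest q.1.2 ∨ q.2 (.timerL (nearest q.1.2)) ≤ q.2 (.timerL j) ∨
    q.2 (.fadeL j (nearest q.1.2)) / p.pathLoss ‖q.1.2 j - q.1.2 (nearest q.1.2)‖ ≤ p.ΓL / p.PL) ∧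
    q.2 (.fadeWL j (nearest q.1.2)) / p.pathLoss ‖q.1.2 (nearest q.1.2) - q.1.1 j‖ ≤ p.ΓL / p.PW}

lemma measurableSet_accessSetL (p : Params) : MeasurableSet (accessSetL p) := by
  have hn : Measurable fun q : Config => nearest q.1.2 := measurable_nearest.comp (by fun_prop)
  have hy : Measurable fun q : Config => q.1.2 (nearest q.1.2) :=
    measurable_apply_index (f := fun i (q : Config) => q.1.2 i) (fun i => by fun_prop) hn
  have ht : Measurable fun q : Config => q.2 (.timerL (nearest q.1.2)) :=
    measurable_apply_index (f := fun i (q : Config) => q.2 (.timerL i)) (fun i => by fun_prop) hn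
  rw [accessSetL, Set.ofPred_forall]
  refine .iInter fun j => ?_
  have hf : Measurable fun q : Config => q.2 (.fadeL j (nearest q.1.2)) :=
    measurable_apply_index (f := fun i (q : Config) => q.2 (.fadeL j i)) (fun i => by fun_prop) hn
  have hg : Measurable fun q : Config => q.2 (.fadeWL j (nearest q.1.2)) :=
    measurable_apply_index (f := fun i (q : Config) => q.2 (.fadeWL j i)) (fun i => by fun_prop) hn
  have hyj : Measurable fun q : Config => q.1.2 j := by fun_prop
  have hxj : Measurable fun q : Config => q.1.1 j := by fun_prop
  have htj : Measurable fun q : Config => q.2 (.timerL j) := by fun_prop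
  have h1 := measurableSet_le ht htj
  have h2 := measurableSet_le (hf.div (p.measurable_pathLoss.comp (hyj.sub hy).norm))
    (measurable_const (a := p.ΓL / p.PL))
  have h3 := measurableSet_le (hg.div (p.measurable_pathLoss.comp (hy.sub hxj).norm))
    (measurable_const (a := p.ΓL / p.PW))
  exact ((measurableSet_eq_fun measurable_const hn).union (h1.union h2)).inter h3

lemma detect_eq_survive {θ s : ℝ} {x y : Plane} (hxy : y ≠ x) :
    1 - s * p.detect θ ‖y - x‖ = p.survive θ s x y := by
  rw [Params.detect, if_neg (norm_ne_zero_iff.2 (sub_ne_zero.2 hxy)), Params.survive]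

lemma seqProd_detect_eq_palmProd {Ω : Type*} {X : ℕ → Ω → Plane} {θ s : ℝ} {ω : Ω}
    (hω : ∀ j, j ≠ tagged X ω → ‖X (tagged X ω) ω‖ < ‖X j ω‖) :
    (seqProd fun j => if j = tagged X ω then 1 else
      ENNReal.ofReal (1 - s * p.detect θ ‖X j ω - X (tagged X ω) ω‖)) =
      palmProd X (p.survive θ s) ω := by
  refine congrArg seqProd (funext fun j => ?_)
  split_ifs with hj
  · rfl
  · rw [detect_eq_survive fun e => (hω j hj).ne (by rw [e])]

lemma IsNetwork.measure_accessW_tagged [IsProbabilityMeasure P] (h : IsNetwork P p 1 2 X Y Z) :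
    P {ω | accessW p X Y Z (tagged X ω) ω = 1} =
      ENNReal.ofReal (∫ r in Set.Ioi (0 : ℝ), (1 - Real.exp (-p.N2W r)) / p.N2W r * p.fW r) := by
  have hθ : 0 < p.Γcs / p.PW := div_pos p.Γcs_pos p.PW_pos
  have hae : {ω | accessW p X Y Z (tagged X ω) ω = 1} =ᵐ[P]
      {ω | (((fun i => X i ω), (fun k => Y k ω)), fun m => Z m ω) ∈ accessSetW p} := by
    filter_upwards [h.ae_timerW_le, h.ae_one_lt_timerL] with ω h1 h2
    refine propext ((accessW_eq_one_iff _ ω).trans (and_iff_left fun m => ?_))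
    -- The condition on each eNB holds through its timer alternative, as AP timers are at most 1.
    exact .inl ((h1 _).trans (h2 m).le)
  have hcond : ∀ᵐ ω ∂P,
      P {ω' | (((fun i => X i ω), (fun k => Y k ω)), fun m => Z m ω') ∈ accessSetW p} =
      ∫⁻ t in Set.Icc 0 1, palmProd X (p.survive (p.Γcs / p.PW) (t - 0)) ω := by
    filter_upwards [h.pppW.ae_norm_tagged_lt p.lamW_pos] with ω hω
    refine (h.measure_access_AP (tagged X ω) (d := fun j => ‖X j ω - X (tagged X ω) ω‖)
      (fun j => norm_nonneg _) hθ.le).trans (lintegral_congr fun t => ?_)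
    rw [seqProd_detect_eq_palmProd hω, sub_zero]
  rw [measure_congr hae, h.measure_eq_lintegral (measurableSet_accessSetW p),
    lintegral_congr_ae hcond, lintegral_lintegral_swap, h.pppW.lintegral_timer_palmProd p
      p.lamW_pos hθ (by norm_num)]
  · rfl
  · exact ((measurable_palmProd_survive p h.pppW.measurable _ 0).comp
      measurable_swap).aemeasurable

/-- With the eNBs fixed, the APs are an independent Poisson process, and their generating functional
around the tagged eNB is the same wherever that eNB is. The expectation therefore factors although
both products involve the tagged location. -/
lemma IsNetwork.lintegral_palmProd_mul [IsProbabilityMeasure P] {a b : ℝ}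
    (h : IsNetwork P p a b X Y Z) {v : Plane → Plane → ℝ} (hv : Measurable (Function.uncurry v))
    {θ : ℝ} (hθ : 0 < θ) :
    ∫⁻ ω, palmProd Y v ω * seqProd (fun j =>
        ENNReal.ofReal (1 - p.detect θ ‖Y (tagged Y ω) ω - X j ω‖)) ∂P =
      (∫⁻ ω, palmProd Y v ω ∂P) *
        ENNReal.ofReal (Real.exp (-(p.lamW * p.detectArea θ 0 0))) := by
  have hd := p.measurable_detect θ
  -- The coordinate process expresses the integrand as a measurable function of the two location
  -- sequences, as Fubini requires.
  let coord : ℕ → (ℕ → Plane) → Plane := fun i y => y i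
  have hcoord : ∀ i, Measurable (coord i) := fun i => measurable_pi_apply i
  let H : (ℕ → Plane) × (ℕ → Plane) → ℝ≥0∞ := fun q => palmProd coord v q.2 *
    seqProd fun j => ENNReal.ofReal (1 - p.detect θ ‖coord (tagged coord q.2) q.2 - q.1 j‖)
  have hH : Measurable H := by
    refine ((measurable_palmProd hcoord hv).comp measurable_snd).mul (measurable_seqProd fun j => ?_)
    have h1 : Measurable fun q : (ℕ → Plane) × (ℕ → Plane) => coord (tagged coord q.2) q.2 :=
      (measurable_tagged_point hcoord).comp measurable_snd
    have h2 : Measurable fun q : (ℕ → Plane) × (ℕ → Plane) => q.1 j := by fun_prop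
    exact ((hd.comp (h1.sub h2).norm).const_sub 1).ennreal_ofReal
  refine (h.lintegral_locations hH).trans ?_
  rw [← lintegral_mul_const _ (measurable_palmProd h.pppL.measurable hv)]
  refine lintegral_congr fun ω => ?_
  have hw : ∀ x, 1 - p.detect θ ‖Y (tagged Y ω) ω - x‖ ∈ Set.Icc (0 : ℝ) 1 := fun x => by
    have := p.detect_mem hθ.le (norm_nonneg (Y (tagged Y ω) ω - x))
    constructor <;> linarith [this.1, this.2]
  have hwm : Measurable fun x => 1 - p.detect θ ‖Y (tagged Y ω) ω - x‖ :=
    (hd.comp (by fun_prop)).const_sub 1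
  have hgen := h.pppW.lintegral_seqProd p.lamW_pos.le hwm hw
    (by simp_rw [sub_sub_cancel]; exact p.integrable_detect hθ _)
  simp_rw [sub_sub_cancel, p.integral_detect] at hgen
  rw [← hgen]
  have hm : Measurable fun ω' => seqProd fun j =>
      ENNReal.ofReal (1 - p.detect θ ‖Y (tagged Y ω) ω - X j ω'‖) :=
    measurable_seqProd fun j => (hwm.comp (h.pppW.measurable j)).ennreal_ofReal
  exact lintegral_const_mul (palmProd Y v ω) hm

lemma IsNetwork.measure_accessL_tagged [IsProbabilityMeasure P] (h : IsNetwork P p 1 2 X Y Z) :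
    P {ω | accessL p X Y Z (tagged Y ω) ω = 1} =
      ENNReal.ofReal (∫ r in Set.Ioi (0 : ℝ),
        (1 - Real.exp (-p.N1L r p.ΓL)) / p.N1L r p.ΓL * p.fL r) *
        ENNReal.ofReal (Real.exp (-p.N3W p.ΓL)) := by
  have hθ : 0 < p.ΓL / p.PL := div_pos p.ΓL_pos p.PL_pos
  have hθ' : 0 < p.ΓL / p.PW := div_pos p.ΓL_pos p.PW_pos
  have hae : {ω | accessL p X Y Z (tagged Y ω) ω = 1} =ᵐ[P]
      {ω | (((fun i => X i ω), (fun k => Y k ω)), fun m => Z m ω) ∈ accessSetL p} := by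
    filter_upwards [h.ae_timerW_le, h.ae_one_lt_timerL] with ω h1 h2
    refine propext ((accessL_eq_one_iff _ ω).trans (and_comm.trans (forall_and.symm.trans
      (forall_congr' fun j => and_congr_right fun _ => ?_))))
    -- Every AP timer is strictly smaller, so only the alternative that the AP goes undetected
    -- remains.
    exact or_iff_right (not_le.2 ((h1 j).trans_lt (h2 _)))
  let u : Ω → ℝ≥0∞ := fun ω => seqProd fun j =>
    ENNReal.ofReal (1 - p.detect (p.ΓL / p.PW) ‖Y (tagged Y ω) ω - X j ω‖)
  have hu : Measurable u := measurable_seqProd fun j =>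
    (((p.measurable_detect _).comp ((measurable_tagged_point h.pppL.measurable).sub
      (h.pppW.measurable j)).norm).const_sub 1).ennreal_ofReal
  have hcond : ∀ᵐ ω ∂P,
      P {ω' | (((fun i => X i ω), (fun k => Y k ω)), fun m => Z m ω') ∈ accessSetL p} =
      ∫⁻ t in Set.Icc 1 2, palmProd Y (p.survive (p.ΓL / p.PL) (t - 1)) ω * u ω := by
    filter_upwards [h.pppL.ae_norm_tagged_lt p.lamL_pos] with ω hω
    refine (h.measure_access_eNB (tagged Y ω) (d := fun j => ‖Y j ω - Y (tagged Y ω) ω‖)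
      (d' := fun j => ‖Y (tagged Y ω) ω - X j ω‖) (fun j => norm_nonneg _)
      (fun j => norm_nonneg _) hθ.le hθ'.le).trans
      (setLIntegral_congr_fun measurableSet_Icc fun t ht => ?_)
    have hdt : ∀ {θ d : ℝ}, 0 ≤ θ → 0 ≤ d → ∀ s : ℝ, 0 ≤ s → 1 - s * p.detect θ d ≤ 1 :=
      fun hθ hd s hs => by
        have := mul_nonneg hs (p.detect_mem hθ hd).1
        linarith
    rw [← seqProd_detect_eq_palmProd hω]
    refine seqProd_mul (fun j => ?_) fun j => ?_
    · split_ifs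
      · exact le_rfl
      · exact ENNReal.ofReal_le_one.2 (hdt hθ.le (norm_nonneg _) _ (by linarith [ht.1]))
    · refine ENNReal.ofReal_le_one.2 ?_
      simpa using hdt hθ'.le (norm_nonneg _) 1 zero_le_one
  have hvm : ∀ s, Measurable (Function.uncurry (p.survive (p.ΓL / p.PL) s)) := fun s =>
    ((p.continuous_survive _).comp (f := fun q : Plane × Plane => (s, q.1, q.2))
      (by fun_prop)).measurable
  have hjoint := measurable_palmProd_survive p h.pppL.measurable (p.ΓL / p.PL) 1
  rw [measure_congr hae, h.measure_eq_lintegral (measurableSet_accessSetL p),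
    lintegral_congr_ae hcond, lintegral_lintegral_swap]
  · simp_rw [u, h.lintegral_palmProd_mul (hvm _) hθ']
    have hm : Measurable fun t => ∫⁻ ω, palmProd Y (p.survive (p.ΓL / p.PL) (t - 1)) ω ∂P :=
      hjoint.lintegral_prod_right'
    rw [lintegral_mul_const _ hm, h.pppL.lintegral_timer_palmProd p
      p.lamL_pos hθ (by norm_num)]
    rfl
  · exact ((hjoint.comp measurable_swap).mul (hu.comp measurable_fst)).aemeasurable

lemma Params.N2W_pos (p : Params) (r : ℝ) : 0 < p.N2W r :=
  mul_pos p.lamW_pos (p.detectArea_pos (div_pos p.Γcs_pos p.PW_pos) _ _)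

lemma Params.N1L_pos (p : Params) (r : ℝ) : 0 < p.N1L r p.ΓL :=
  mul_pos p.lamL_pos (p.detectArea_pos (div_pos p.ΓL_pos p.PL_pos) _ _)

lemma Params.N3W_pos (p : Params) : 0 < p.N3W p.ΓL :=
  mul_pos p.lamW_pos (p.detectArea_pos (div_pos p.ΓL_pos p.PW_pos) _ _)

lemma Params.measurable_N2W (p : Params) : Measurable p.N2W :=
  (p.measurable_detectArea (p.Γcs / p.PW)).const_mul p.lamW

lemma Params.measurable_N1L (p : Params) : Measurable fun r => p.N1L r p.ΓL :=
  (p.measurable_detectArea (p.ΓL / p.PL)).const_mul p.lamL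

end Main

end Coexistence

end

open Coexistence in
theorem mainTheorem11 {Ω : Type*} [MeasurableSpace Ω] (P : Measure Ω) [IsProbabilityMeasure P]
    (p : Params) (X Y : ℕ → Ω → Plane) (Z : Mark → Ω → ℝ) (h : IsNetwork P p 1 2 X Y Z) :
    (∀ r : ℝ, 0 < r → 0 < p.N2W r ∧ 0 < p.N1L r p.ΓL) ∧ 0 < p.N3W p.ΓL ∧
    IntegrableOn (fun r => (1 - Real.exp (-p.N2W r)) / p.N2W r * p.fW r) (Set.Ioi 0) ∧
    IntegrableOn (fun r => Real.exp (-p.N3W p.ΓL) *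
      ((1 - Real.exp (-p.N1L r p.ΓL)) / p.N1L r p.ΓL) * p.fL r) (Set.Ioi 0) ∧
    taggedMAPW P p X Y Z =
      ∫ r in Set.Ioi (0 : ℝ), (1 - Real.exp (-p.N2W r)) / p.N2W r * p.fW r ∧
    taggedMAPL P p X Y Z =
      ∫ r in Set.Ioi (0 : ℝ), Real.exp (-p.N3W p.ΓL) *
        ((1 - Real.exp (-p.N1L r p.ΓL)) / p.N1L r p.ΓL) * p.fL r := by
  have hW := p.measurable_N2W
  have hL := p.measurable_N1L
  have hIW := integrableOn_mul_density p.lamW_pos (q := fun r => (1 - Real.exp (-p.N2W r)) / p.N2W r)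
    (by fun_prop) fun r _ => one_sub_exp_neg_div_mem (p.N2W_pos r)
  have hIL := integrableOn_mul_density p.lamL_pos
    (q := fun r => (1 - Real.exp (-p.N1L r p.ΓL)) / p.N1L r p.ΓL)
    (by fun_prop) fun r _ => one_sub_exp_neg_div_mem (p.N1L_pos r)
  -- Strict positivity also certifies finiteness: a divergent Bochner integral would be 0.
  refine ⟨fun r _ => ⟨p.N2W_pos r, p.N1L_pos r⟩, p.N3W_pos, hIW, ?_, ?_, ?_⟩
  · simp_rw [mul_assoc (Real.exp (-p.N3W p.ΓL))]
    exact hIL.const_mul _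
  · rw [taggedMAPW, measureReal_def, h.measure_accessW_tagged, ENNReal.toReal_ofReal]
    refine setIntegral_nonneg measurableSet_Ioi fun r (hr : 0 < r) => mul_nonneg
      (one_sub_exp_neg_div_mem (p.N2W_pos r)).1 ?_
    have := p.lamW_pos
    unfold Params.fW
    positivity
  · simp_rw [mul_assoc (Real.exp (-p.N3W p.ΓL))]
    rw [taggedMAPL, measureReal_def, h.measure_accessL_tagged, ENNReal.toReal_mul,
      ENNReal.toReal_ofReal, ENNReal.toReal_ofReal (Real.exp_pos _).le, integral_const_mul, mul_comm]
    refine setIntegral_nonneg measurableSet_Ioi fun r (hr : 0 < r) => mul_nonneg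
      (one_sub_exp_neg_div_mem (p.N1L_pos r)).1 ?_
    have := p.lamL_pos
    unfold Params.fL
    positivity
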